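/- Let $n\ge 1$ and $X=\mathbb P^n_{\mathbb C}$, so that $-K_X=\mathcal O(n+1)$; take the minimal level $k=1/(n+1)$, for which $-kK_X=\mathcal O(1)$ and $N=\dim H^0(X,-kK_X)=n+1$. Let $dV$ be the Fubini–Study volume form, given in the affine chart $z\mapsto[1:z_1:\dots:z_n]$ by $(1+|z|^2)^{-(n+1)}\,d\lambda(z)$, with $d\lambda$ Lebesgue measure, and let $$\|\det S\|(x_1,\dots,x_{n+1})=\frac{|\det(\mathbf Z_1,\dots,\mathbf Z_{n+1})|}{|\mathbf Z_1|\cdots|\mathbf Z_{n+1}|},\qquad x_j=[\mathbf Z_j],\ \mathbf Z_j\in\mathbb C^{n+1}\setminus\{0\},$$ be the Fubini–Study norm of the Slater determinant of the basis of $H^0(\mathbb P^n,\mathcal O(1))$ given by the homogeneous coordinates. Put $$\mathcal Z(\beta)=\int_{(\mathbb P^n)^{n+1}}\|\det S\|^{2\beta/k}\,dV^{\otimes(n+1)},\qquad \Omega=\{\beta\in\mathbb C:\operatorname{Re}\beta>-1/(n+1)\}.$$ Then: (1) The integral converges absolutely if and only if $\beta\in\Omega$. (2) There is a constant $c_n>0$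 depending only on $n$ such that for all $\beta\in\Omega$ $$\mathcal Z(\beta)=c_n\,\frac{\prod_{j=1}^n\Gamma(\beta(n+1)+j)}{\Gamma(\beta(n+1)+n+1)^n},$$ and $\mathcal Z$ extends to a meromorphic function on $\mathbb C$, given by the same formula at every $\beta$ with $\beta(n+1)\notin\{-1,-2,\dots\}$; this extension has no zeros in $\mathbb C$. (3) $\mathcal Z$ is holomorphic and zero-free on $\Omega$, and $\Omega$ is the maximal strip of holomorphicity: for no $a<-1/(n+1)$ does $\mathcal Z$ extend holomorphically to $\{\operatorname{Re}\beta>a\}$. (4) For $\beta\in\Omega$ and $s=\beta(n+1)$ the zeta integral of the trivial representation of $GL(n+1,\mathbb C)$, $$L(s)=\int_{\mathrm{Mat}(n+1,\mathbb C)}|\det A|^{2s}e^{-|A|^2}\,dA,\qquad |A|^2=\sum_{i,j}|A_{ij}|^2,$$ with $dA$ Lebesgue measure, converges absolutely, and $$\mathcal Z(\beta)=c_n'\,\Gamma(s+n+1)^{-(n+1)}L(s),\qquad L(s)=c_n''\,(2\pi)^{(n+1)s}\,L\!\left(s+\tfrac{n+2}2,\mathbf 1_{GL(n+1,\mathbb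 C)}\right),$$ with constants $c_n',c_n''>0$ depending only on $n$. Here $L(w,\mathbf 1_{GL(N,\mathbb C)})=\prod_{j=1}^{N}\Gamma_{\mathbb C}\!\left(w+\tfrac{N+1}2-j\right)$, with $\Gamma_{\mathbb C}(w)=2(2\pi)^{-w}\Gamma(w)$, is the standard local L-factor of the trivial representation. -/

import Mathlib

open MeasureTheory
open scoped LinearAlgebra.Projectivization

noncomputable section

/-- Complex projective space `ℙⁿ`: the lines through the origin of `ℂⁿ⁺¹`. -/
abbrev CPn (n : ℕ) : Type := ℙ ℂ (EuclideanSpace ℂ (Fin (n + 1)))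

/-- The quotient topology of `ℂⁿ⁺¹ ∖ {0} → ℙⁿ`. -/
instance CPn.instTopologicalSpace (n : ℕ) : TopologicalSpace (CPn n) :=
  TopologicalSpace.coinduced
    (fun v : {v : EuclideanSpace ℂ (Fin (n + 1)) // v ≠ 0} => Projectivization.mk ℂ v.1 v.2)
    inferInstance

/-- The Borel σ-algebra of `ℙⁿ`. -/
instance CPn.instMeasurableSpace (n : ℕ) : MeasurableSpace (CPn n) := borel (CPn n)

instance CPn.instBorelSpace (n : ℕ) : BorelSpace (CPn n) := ⟨rfl⟩

/-- The vector `(1, z₁, …, zₙ)` of `ℂⁿ⁺¹`. -/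
def affineVec (n : ℕ) (z : Fin n → ℂ) : EuclideanSpace ℂ (Fin (n + 1)) :=
  WithLp.toLp 2 (Fin.cons 1 z)

theorem affineVec_ne_zero (n : ℕ) (z : Fin n → ℂ) : affineVec n z ≠ 0 := by
  intro h
  have h0 := congrArg (fun v : EuclideanSpace ℂ (Fin (n + 1)) => v 0) h
  simp [affineVec] at h0

/-- The affine chart `z ↦ [1 : z₁ : ⋯ : zₙ]` of `ℙⁿ`. -/
def affineChart (n : ℕ) (z : Fin n → ℂ) : CPn n :=
  Projectivization.mk ℂ (affineVec n z) (affineVec_ne_zero n z)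

/-- The Fubini–Study volume form on `ℙⁿ`.  The Fubini–Study metric on `-K = 𝒪(n+1)` gives the
local frame `∂/∂z₁ ∧ ⋯ ∧ ∂/∂zₙ` (that is, `Z₀ⁿ⁺¹`) the squared length
`(|Z₀|² / |Z|²)ⁿ⁺¹ = (1 + |z|²)^{-(n+1)}`, so this is the density of the corresponding volume form
with respect to Lebesgue measure `dλ(z)` in the affine chart.  The hyperplane `Z₀ = 0` that the
chart misses is a null set of any volume form. -/
def fsVolume (n : ℕ) : Measure (CPn n) :=
  ((volume : Measure (Fin n → ℂ)).withDensity
    (fun z => ENNReal.ofReal (((1 + ∑ i, ‖z i‖ ^ 2) ^ (n + 1))⁻¹))).map (affineChart n)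

/-- Holomorphic sections of `𝒪(1) → ℙⁿ`, i.e. linear forms on `ℂⁿ⁺¹`. -/
abbrev SectionsO1 (n : ℕ) : Type := Module.Dual ℂ (EuclideanSpace ℂ (Fin (n + 1)))

/-- The `i`-th homogeneous coordinate `Zᵢ`, as a section of `𝒪(1)`. -/
def coordSection (n : ℕ) (i : Fin (n + 1)) : SectionsO1 n where
  toFun v := v i
  map_add' _ _ := rfl
  map_smul' _ _ := rfl

/-- The pointwise Fubini–Study norm `‖det S‖(x₁, …, x_N) = |det (sᵢ(Zⱼ))| / (|Z₁| ⋯ |Z_N|)` of the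
Slater determinant of sections `s₁, …, s_N` of `𝒪(1)`, where `Zⱼ` is any vector representing the
point `xⱼ` of `ℙⁿ`. -/
def slaterNorm {n N : ℕ} (s : Fin N → SectionsO1 n) (x : Fin N → CPn n) : ℝ :=
  ‖Matrix.det (Matrix.of fun i j => s i (x j).rep)‖ / ∏ j, ‖(x j).rep‖

/-- The norm does not depend on the representatives. -/
theorem slaterNorm_mk {n N : ℕ} (s : Fin N → SectionsO1 n)
    (Z : Fin N → EuclideanSpace ℂ (Fin (n + 1))) (hZ : ∀ j, Z j ≠ 0) :
    slaterNorm s (fun j => Projectivization.mk ℂ (Z j) (hZ j)) =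
      ‖Matrix.det (Matrix.of fun i j => s i (Z j))‖ / ∏ j, ‖Z j‖ := by
  choose a ha using fun j => Projectivization.exists_smul_eq_mk_rep ℂ (Z j) (hZ j)
  have key : (Matrix.of fun i j => s i (Projectivization.mk ℂ (Z j) (hZ j)).rep) =
      Matrix.of fun i j => (a j : ℂ) * (Matrix.of fun i j => s i (Z j)) i j := by
    ext i j
    simp [← ha j, Units.smul_def]
  have hn : ∀ j, ‖(Projectivization.mk ℂ (Z j) (hZ j)).rep‖ = ‖(a j : ℂ)‖ * ‖Z j‖ := by
    intro j
    rw [← ha j, Units.smul_def, norm_smul]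
  unfold slaterNorm
  rw [key, Matrix.det_mul_row, norm_mul, norm_prod]
  simp only [hn, Finset.prod_mul_distrib]
  rw [mul_div_mul_left]
  exact Finset.prod_ne_zero_iff.mpr fun j _ => norm_ne_zero_iff.mpr (a j).ne_zero

/-- The minimal level `k = 1/(n+1)` on `ℙⁿ`, for which `-kK = 𝒪(1)` and `N = dim H⁰(𝒪(1)) = n+1`. -/
def minLevel (n : ℕ) : ℂ := 1 / ((n : ℂ) + 1)

/-- The integrand `‖det S‖^{2β/k}` on `(ℙⁿ)ⁿ⁺¹` at the minimal level, for the basis of `H⁰(𝒪(1))`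
given by the homogeneous coordinates. -/
def partitionIntegrand (n : ℕ) (β : ℂ) (x : Fin (n + 1) → CPn n) : ℂ :=
  (slaterNorm (coordSection n) x : ℂ) ^ (2 * β / minLevel n)

/-- The partition function `𝒵(β) = ∫_{(ℙⁿ)ⁿ⁺¹} ‖det S‖^{2β/k} dV^{⊗(n+1)}`. -/
def partitionFunction (n : ℕ) (β : ℂ) : ℂ :=
  ∫ x, partitionIntegrand n β x ∂(Measure.pi fun _ : Fin (n + 1) => fsVolume n)

/-- The half-plane `Re β > -1/(n+1)`. -/
def strip (n : ℕ) : Set ℂ := {β | -(1 / ((n : ℝ) + 1)) < β.re}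

/-- `∏_{j=1}^n Γ(β(n+1)+j) / Γ(β(n+1)+n+1)^n`. -/
def gammaQuotient (n : ℕ) (β : ℂ) : ℂ :=
  (∏ j ∈ Finset.Icc 1 n, Complex.Gamma (β * (n + 1) + j)) /
    Complex.Gamma (β * (n + 1) + n + 1) ^ n

/-- The integrand `|det A|_ℂ^s e^{-|A|²}` on `Mat(N, ℂ)`; here `|z|_ℂ = |z|²` is the normalized
absolute value of `ℂ`. -/
def zetaIntegrand (N : ℕ) (s : ℂ) (A : Fin N → Fin N → ℂ) : ℂ :=
  ((‖Matrix.det (Matrix.of A)‖ ^ 2 : ℝ) : ℂ) ^ s * (Real.exp (-∑ i, ∑ j, ‖A i j‖ ^ 2) : ℂ)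

/-- The Archimedean zeta integral `∫_{Mat(N, ℂ)} |det A|_ℂ^s e^{-|A|²} dA` of the trivial
representation of `GL(N, ℂ)`, with `dA` Lebesgue measure. -/
def zetaIntegral (N : ℕ) (s : ℂ) : ℂ :=
  ∫ A : Fin N → Fin N → ℂ, zetaIntegrand N s A

/-- The standard local L-factor of the trivial representation of `GL(N, ℂ)`:
`L(s, 1) = ∏_{j=1}^N Γ_ℂ(s + (N+1)/2 - j)` with `Γ_ℂ(s) = 2 (2π)^{-s} Γ(s)`. -/
def standardLFactor (N : ℕ) (s : ℂ) : ℂ :=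
  ∏ j ∈ Finset.Icc 1 N, Complex.Gammaℂ (s + ((N : ℂ) + 1) / 2 - j)

end

/-!
Let `A` be a square matrix of size `n + 1` with independent standard complex Gaussian entries. The
squared length of a row is Gamma distributed with shape `n + 1` and independent of the direction of
the row, which is distributed according to the normalized Fubini–Study volume. Hence `|det A|²` is
the product of `n + 1` independent Gamma variables of shape `n + 1` and an independent copy of
`‖det S‖²`. On the other hand, rotating the first row to a coordinate axis by a unitary matrix
exhibits `|det A|²` as a product of independent Gamma variables of shapes `1, …, n + 1`.

Taking moments of order `s = β(n+1)` of both descriptions gives `𝒵(β)` as a quotient of Gamma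
functions, while the moment of `|det A|²` is the zeta integral up to a power of `π`. The quotient
telescopes to `∏ (s + i)⁻ⁱ`, a reciprocal of a polynomial whose rightmost root is `s = -1`.
-/

noncomputable section

open Matrix
open scoped ENNReal Nat

section Pi

theorem measurePreserving_finCons {n : ℕ} {E : Fin (n + 1) → Type*} [∀ i, MeasurableSpace (E i)]
    (μ : ∀ i, Measure (E i)) [∀ i, SigmaFinite (μ i)] :
    MeasurePreserving (fun p : E 0 × (∀ i : Fin n, E i.succ) => (Fin.cons p.1 p.2 : ∀ i, E i))
      ((μ 0).prod (Measure.pi fun i => μ i.succ)) (Measure.pi μ) := by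
  have hcons : (fun p : E 0 × (∀ i : Fin n, E i.succ) => (Fin.cons p.1 p.2 : ∀ i, E i)) =
      (MeasurableEquiv.piFinSuccAbove E 0).symm := by
    ext p i
    rw [MeasurableEquiv.piFinSuccAbove_symm_apply, Fin.insertNthEquiv_zero]
    rfl
  rw [hcons]
  exact (measurePreserving_piFinSuccAbove μ 0).symm

theorem lintegral_pi_fin_prod_eq_prod {n : ℕ} {E : Fin n → Type*} [∀ i, MeasurableSpace (E i)]
    (μ : ∀ i, Measure (E i)) [∀ i, SigmaFinite (μ i)] {f : ∀ i, E i → ℝ≥0∞}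
    (hf : ∀ i, Measurable (f i)) :
    ∫⁻ x, ∏ i, f i (x i) ∂Measure.pi μ = ∏ i, ∫⁻ x, f i x ∂μ i := by
  induction n with
  | zero => simp
  | succ n ih =>
    have htail : Measurable fun y : ∀ i : Fin n, E i.succ => ∏ i, f i.succ (y i) :=
      Finset.measurable_prod _ fun i _ => (hf i.succ).comp (measurable_pi_apply i)
    rw [← (measurePreserving_finCons μ).lintegral_comp (by fun_prop), Fin.prod_univ_succ,
      ← ih (fun i => μ i.succ) fun i => hf i.succ]
    simp only [Fin.prod_univ_succ, Fin.cons_zero, Fin.cons_succ]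
    exact lintegral_prod_mul (hf 0).aemeasurable htail.aemeasurable

variable {ι : Type*} [Fintype ι]

theorem lintegral_pi_prod_eq_prod {E : ι → Type*} [∀ i, MeasurableSpace (E i)]
    (μ : ∀ i, Measure (E i)) [∀ i, SigmaFinite (μ i)] {f : ∀ i, E i → ℝ≥0∞}
    (hf : ∀ i, Measurable (f i)) :
    ∫⁻ x, ∏ i, f i (x i) ∂Measure.pi μ = ∏ i, ∫⁻ x, f i x ∂μ i := by
  let e := (Fintype.equivFin ι).symm
  rw [← (measurePreserving_piCongrLeft _ e).lintegral_comp (by fun_prop)]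
  simp_rw [← e.prod_comp, MeasurableEquiv.coe_piCongrLeft, Equiv.piCongrLeft_apply_apply,
    lintegral_pi_fin_prod_eq_prod _ fun i => hf (e i)]

theorem pi_withDensity_eq {E : ι → Type*} [∀ i, MeasurableSpace (E i)]
    (μ : ∀ i, Measure (E i)) [∀ i, SigmaFinite (μ i)] {f : ∀ i, E i → ℝ≥0∞}
    (hf : ∀ i, Measurable (f i)) [∀ i, SigmaFinite ((μ i).withDensity (f i))] :
    Measure.pi (fun i => (μ i).withDensity (f i)) =
      (Measure.pi μ).withDensity fun x => ∏ i, f i (x i) := by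
  refine Measure.pi_eq fun s hs => ?_
  rw [withDensity_apply _ (MeasurableSet.univ_pi hs), Measure.restrict_pi_pi,
    lintegral_pi_prod_eq_prod _ hf]
  exact Finset.prod_congr rfl fun i _ => (withDensity_apply _ (hs i)).symm

theorem pi_const_smul_eq {E : ι → Type*} [∀ i, MeasurableSpace (E i)]
    (μ : ∀ i, Measure (E i)) [∀ i, SigmaFinite (μ i)] (c : ℝ≥0∞) [∀ i, SigmaFinite (c • μ i)] :
    Measure.pi (fun i => c • μ i) = c ^ Fintype.card ι • Measure.pi μ :=
  Measure.pi_eq fun s _ => by simp [Measure.pi_pi, Finset.prod_mul_distrib]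

end Pi

theorem measurableEmbedding_pi {ι : Type*} [Countable ι] {E F : ι → Type*}
    [∀ i, MeasurableSpace (E i)] [∀ i, MeasurableSpace (F i)] [∀ i, Nonempty (E i)]
    {f : ∀ i, E i → F i}
    (hf : ∀ i, MeasurableEmbedding (f i)) : MeasurableEmbedding (Pi.map f) := by
  refine MeasurableEmbedding.of_measurable_inverse (g := Pi.map fun i => (hf i).invFun)
    (measurable_pi_lambda _ fun i => (hf i).measurable.comp (measurable_pi_apply i)) ?_
    (measurable_pi_lambda _ fun i => (hf i).measurable_invFun.comp (measurable_pi_apply i))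
    fun x => funext fun i => (hf i).leftInverse_invFun (x i)
  rw [Set.range_piMap]
  exact MeasurableSet.univ_pi fun i => (hf i).measurableSet_range

section LinearMap

variable {E : Type*} [NormedAddCommGroup E] [NormedSpace ℂ E] [FiniteDimensional ℂ E]
  [MeasurableSpace E] [BorelSpace E] (μ : Measure E) [μ.IsAddHaarMeasure]

theorem map_complex_linearMap_addHaar {f : E →ₗ[ℂ] E} (hf : LinearMap.det f ≠ 0) :
    μ.map f = ENNReal.ofReal ((‖LinearMap.det f‖ ^ 2)⁻¹) • μ := by
  have : FiniteDimensional ℝ E := FiniteDimensional.complexToReal E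
  have hdet : LinearMap.det (f.restrictScalars ℝ) = ‖LinearMap.det f‖ ^ 2 := by
    rw [LinearMap.det_restrictScalars, Algebra.norm_complex_apply, Complex.normSq_eq_norm_sq]
  have h := Measure.map_linearMap_addHaar_eq_smul_addHaar μ (f := f.restrictScalars ℝ)
    (by rw [hdet]; simpa using hf)
  rwa [hdet, abs_of_nonneg (by positivity)] at h

theorem lintegral_comp_complex_smul {t : ℂ} (ht : t ≠ 0) (F : E → ℝ≥0∞) :
    ∫⁻ w, F w ∂μ = ENNReal.ofReal ((‖t‖ ^ 2) ^ Module.finrank ℂ E) * ∫⁻ z, F (t • z) ∂μ := by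
  have hmap : μ.map (t • ·) = ENNReal.ofReal (((‖t‖ ^ 2) ^ Module.finrank ℂ E)⁻¹) • μ := by
    have hdet : LinearMap.det (t • LinearMap.id : E →ₗ[ℂ] E) = t ^ Module.finrank ℂ E := by
      simp [LinearMap.det_smul]
    have h := map_complex_linearMap_addHaar μ (f := t • LinearMap.id)
      (by rw [hdet]; exact pow_ne_zero _ ht)
    rwa [hdet, norm_pow, pow_right_comm] at h
  have hpos : 0 < (‖t‖ ^ 2) ^ Module.finrank ℂ E := by positivity
  rw [← (measurableEmbedding_const_smul₀ ht).lintegral_map, hmap, lintegral_smul_measure,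
    smul_eq_mul, ← mul_assoc, ← ENNReal.ofReal_mul hpos.le, mul_inv_cancel₀ hpos.ne',
    ENNReal.ofReal_one, one_mul]

end LinearMap

theorem lintegral_Ioi_comp_mul_left {b : ℝ} (hb : 0 < b) (h : ℝ → ℝ≥0∞) :
    ∫⁻ x in Set.Ioi 0, h x = ENNReal.ofReal b * ∫⁻ x in Set.Ioi 0, h (b * x) := by
  have himage : (fun x => b * x) '' Set.Ioi 0 = Set.Ioi 0 := by
    simpa using Set.image_mul_left_Ioi hb 0
  have := lintegral_image_eq_lintegral_abs_deriv_mul (s := Set.Ioi 0) (f := fun x => b * x)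
    (f' := fun _ => b) measurableSet_Ioi
    (fun x _ => by simpa using ((hasDerivAt_id x).const_mul b).hasDerivWithinAt)
    (mul_right_injective₀ hb.ne').injOn h
  rwa [himage, lintegral_const_mul' _ _ ENNReal.ofReal_ne_top, abs_of_pos hb] at this

theorem lintegral_Ioi_comp_sq (h : ℝ → ℝ≥0∞) :
    ∫⁻ x in Set.Ioi 0, h x = ∫⁻ r in Set.Ioi 0, ENNReal.ofReal (2 * r) * h (r ^ 2) := by
  have himage : (fun r : ℝ => r ^ 2) '' Set.Ioi 0 = Set.Ioi 0 := by
    refine Set.Subset.antisymm ?_ fun y hy => ⟨√y, Real.sqrt_pos.2 hy, Real.sq_sqrt hy.le⟩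
    rintro - ⟨r, hr, rfl⟩
    exact pow_pos (Set.mem_Ioi.1 hr) 2
  have hinj : Set.InjOn (fun r : ℝ => r ^ 2) (Set.Ioi 0) := fun r hr s hs =>
    (pow_left_inj₀ (le_of_lt hr) (le_of_lt hs) two_ne_zero).1
  have := lintegral_image_eq_lintegral_abs_deriv_mul measurableSet_Ioi
    (fun r _ => by simpa using (hasDerivAt_pow 2 r).hasDerivWithinAt) hinj h
  rw [himage] at this
  rw [this]
  refine setLIntegral_congr_fun measurableSet_Ioi fun r hr => ?_
  simp only [abs_of_pos (mul_pos zero_lt_two (Set.mem_Ioi.1 hr))]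

theorem map_norm_sq_volume_complex :
    (volume : Measure ℂ).map (fun t => ‖t‖ ^ 2) =
      ENNReal.ofReal Real.pi • volume.restrict (Set.Ioi 0) := by
  refine Measure.ext_of_lintegral _ fun h hh => ?_
  rw [lintegral_map hh (by fun_prop), lintegral_smul_measure, lintegral_Ioi_comp_sq,
    ← Complex.lintegral_comp_polarCoord_symm, polarCoord_target, Measure.volume_eq_prod,
    ← Measure.prod_restrict]
  simp only [Complex.norm_polarCoord_symm, sq_abs, smul_eq_mul]
  rw [lintegral_prod _ (by fun_prop)]
  simp only [lintegral_const, Measure.restrict_apply_univ, Real.volume_Ioo, sub_neg_eq_add]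
  rw [lintegral_mul_const' _ _ ENNReal.ofReal_ne_top,
    ← lintegral_mul_const' _ _ ENNReal.ofReal_ne_top,
    ← lintegral_const_mul' _ _ ENNReal.ofReal_ne_top]
  refine lintegral_congr fun r => ?_
  rw [← two_mul, ENNReal.ofReal_mul zero_le_two, ENNReal.ofReal_mul zero_le_two]
  ring

section Moments

/-- The absolute moment of complex order `s` of a measure on the line. -/
def absMoment (μ : Measure ℝ) (s : ℂ) : ℝ≥0∞ := ∫⁻ x, ‖(x : ℂ) ^ s‖ₑ ∂μ

/-- The moment of complex order `s` of a measure on the line; for measures on `[0, ∞)` this is the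
Mellin transform at `s + 1`. -/
def powMoment (μ : Measure ℝ) (s : ℂ) : ℂ := ∫ x, (x : ℂ) ^ s ∂μ

theorem measurable_ofReal_cpow_const (s : ℂ) : Measurable fun x : ℝ => (x : ℂ) ^ s := by
  fun_prop

theorem enorm_ofReal_cpow_of_pos {x : ℝ} (hx : 0 < x) (s : ℂ) :
    ‖(x : ℂ) ^ s‖ₑ = ENNReal.ofReal (x ^ s.re) := by
  rw [← ofReal_norm, Complex.norm_cpow_eq_rpow_re_of_pos hx]

theorem ofReal_prod_cpow {ι : Type*} (u : Finset ι) {x : ι → ℝ} (hx : ∀ i ∈ u, 0 ≤ x i) (s : ℂ) :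
    ((∏ i ∈ u, x i : ℝ) : ℂ) ^ s = ∏ i ∈ u, (x i : ℂ) ^ s := by
  induction u using Finset.cons_induction with
  | empty => simp
  | cons i u hi ih =>
    have hu : ∀ j ∈ u, 0 ≤ x j := fun j hj => hx j (Finset.mem_cons_of_mem hj)
    rw [Finset.prod_cons, Finset.prod_cons, ← ih hu, Complex.ofReal_mul,
      Complex.mul_cpow_ofReal_nonneg (hx i (Finset.mem_cons_self i u)) (Finset.prod_nonneg hu)]

theorem integrable_cpow_iff_absMoment_ne_top (μ : Measure ℝ) (s : ℂ) :
    Integrable (fun x : ℝ => (x : ℂ) ^ s) μ ↔ absMoment μ s ≠ ∞ := by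
  rw [absMoment, ← lt_top_iff_ne_top]
  exact ⟨fun h => h.2, fun h => ⟨(measurable_ofReal_cpow_const s).aestronglyMeasurable, h⟩⟩

theorem enorm_cpow_le_one_add {x : ℝ} (hx : 0 ≤ x) {s t : ℂ} (hst : s.re ≤ t.re)
    (ht : t.re ≤ 0) : ‖(x : ℂ) ^ t‖ₑ ≤ 1 + ‖(x : ℂ) ^ s‖ₑ := by
  rcases hx.eq_or_lt with rfl | hx
  · refine le_add_right ?_
    by_cases h : t = 0 <;> simp [h]
  rw [enorm_ofReal_cpow_of_pos hx, enorm_ofReal_cpow_of_pos hx]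
  rcases le_total 1 x with h1 | h1
  · refine le_add_right ?_
    rw [← ENNReal.ofReal_one]
    exact ENNReal.ofReal_le_ofReal (Real.rpow_le_one_of_one_le_of_nonpos h1 ht)
  · exact le_add_left (ENNReal.ofReal_le_ofReal (Real.rpow_le_rpow_of_exponent_ge hx h1 hst))

theorem absMoment_ne_top_of_re_le {μ : Measure ℝ} [IsFiniteMeasure μ] (hμ : ∀ᵐ x ∂μ, 0 ≤ x)
    {s t : ℂ} (hst : s.re ≤ t.re) (ht : t.re ≤ 0) (hs : absMoment μ s ≠ ∞) :
    absMoment μ t ≠ ∞ := by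
  have hle : absMoment μ t ≤ μ Set.univ + absMoment μ s := by
    rw [← lintegral_one, absMoment, absMoment, ← lintegral_add_left measurable_const]
    exact lintegral_mono_ae (hμ.mono fun x hx => enorm_cpow_le_one_add hx hst ht)
  exact ne_top_of_le_ne_top (ENNReal.add_ne_top.2 ⟨measure_ne_top μ _, hs⟩) hle

theorem absMoment_ne_zero {μ : Measure ℝ} (hμ : μ (Set.Ioi 0) ≠ 0) (s : ℂ) :
    absMoment μ s ≠ 0 := by
  rw [absMoment, ← pos_iff_ne_zero, lintegral_pos_iff_support (by fun_prop)]
  refine (pos_iff_ne_zero.2 hμ).trans_le (measure_mono fun x hx => ?_)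
  have hx : (0 : ℝ) < x := hx
  simp [Complex.cpow_eq_zero_iff, hx.ne']

section MulConvolution

variable {μ ν : Measure ℝ}

theorem ae_prod_cpow_mul (hμ : ∀ᵐ x ∂μ, 0 ≤ x) (hν : ∀ᵐ x ∂ν, 0 ≤ x) (s : ℂ) :
    ∀ᵐ p ∂μ.prod ν, ((p.1 * p.2 : ℝ) : ℂ) ^ s = (p.1 : ℂ) ^ s * (p.2 : ℂ) ^ s := by
  filter_upwards [Measure.quasiMeasurePreserving_fst.ae hμ,
    Measure.quasiMeasurePreserving_snd.ae hν] with p h1 h2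
  rw [Complex.ofReal_mul, Complex.mul_cpow_ofReal_nonneg h1 h2]

variable [SFinite ν]

theorem absMoment_mconv (hμ : ∀ᵐ x ∂μ, 0 ≤ x) (hν : ∀ᵐ x ∂ν, 0 ≤ x) (s : ℂ) :
    absMoment (μ ∗ₘ ν) s = absMoment μ s * absMoment ν s := by
  rw [absMoment, Measure.mconv, lintegral_map (by fun_prop) (by fun_prop), absMoment, absMoment,
    ← lintegral_prod_mul (by fun_prop) (by fun_prop)]
  refine lintegral_congr_ae ?_
  filter_upwards [ae_prod_cpow_mul hμ hν s] with p hp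
  rw [hp, enorm_mul]

theorem powMoment_mconv [SFinite μ] (hμ : ∀ᵐ x ∂μ, 0 ≤ x) (hν : ∀ᵐ x ∂ν, 0 ≤ x) (s : ℂ) :
    powMoment (μ ∗ₘ ν) s = powMoment μ s * powMoment ν s := by
  rw [powMoment, Measure.mconv, integral_map (by fun_prop)
    (measurable_ofReal_cpow_const s).aestronglyMeasurable, powMoment, powMoment,
    ← integral_prod_mul]
  exact integral_congr_ae (ae_prod_cpow_mul hμ hν s)

end MulConvolution

section ProdLaw

variable {ι : Type*} [Fintype ι]

/-- The distribution of the product of independent real random variables with laws `μ i`. -/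
def prodLaw (μ : ι → Measure ℝ) : Measure ℝ := (Measure.pi μ).map fun x => ∏ i, x i

instance prodLaw.instIsProbabilityMeasure (μ : ι → Measure ℝ) [∀ i, IsProbabilityMeasure (μ i)] :
    IsProbabilityMeasure (prodLaw μ) :=
  Measure.isProbabilityMeasure_map (by fun_prop)

variable {μ : ι → Measure ℝ} [∀ i, SigmaFinite (μ i)]

theorem ae_pi_nonneg (hμ : ∀ i, ∀ᵐ x ∂μ i, 0 ≤ x) : ∀ᵐ x ∂Measure.pi μ, ∀ i, 0 ≤ x i :=
  ae_all_iff.2 fun i => (Measure.quasiMeasurePreserving_eval μ i).ae (hμ i)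

theorem ae_prodLaw_nonneg (hμ : ∀ i, ∀ᵐ x ∂μ i, 0 ≤ x) : ∀ᵐ x ∂prodLaw μ, 0 ≤ x := by
  rw [prodLaw, ae_map_iff (by fun_prop) measurableSet_Ici]
  exact (ae_pi_nonneg hμ).mono fun x hx => Finset.prod_nonneg fun i _ => hx i

theorem absMoment_prodLaw (hμ : ∀ i, ∀ᵐ x ∂μ i, 0 ≤ x) (s : ℂ) :
    absMoment (prodLaw μ) s = ∏ i, absMoment (μ i) s := by
  simp only [absMoment]
  rw [prodLaw, lintegral_map (by fun_prop) (by fun_prop),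
    ← lintegral_pi_prod_eq_prod μ fun _ => by fun_prop]
  refine lintegral_congr_ae ?_
  filter_upwards [ae_pi_nonneg hμ] with x hx
  rw [ofReal_prod_cpow _ fun i _ => hx i, ← ofReal_norm, norm_prod,
    ENNReal.ofReal_prod_of_nonneg fun _ _ => norm_nonneg _]
  simp only [ofReal_norm]

theorem powMoment_prodLaw (hμ : ∀ i, ∀ᵐ x ∂μ i, 0 ≤ x) (s : ℂ) :
    powMoment (prodLaw μ) s = ∏ i, powMoment (μ i) s := by
  simp only [powMoment]
  rw [prodLaw, integral_map (by fun_prop) (measurable_ofReal_cpow_const s).aestronglyMeasurable,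
    ← integral_fintype_prod_eq_prod]
  exact integral_congr_ae <| (ae_pi_nonneg hμ).mono fun x hx =>
    ofReal_prod_cpow _ (fun i _ => hx i) s

end ProdLaw

end Moments

section StdGamma

/-- The Gamma distribution of shape `a` and rate `1`, with density `x ^ (a - 1) e⁻ˣ / Γ(a)` on
`(0, ∞)`. -/
def stdGamma (a : ℝ) : Measure ℝ := ProbabilityTheory.gammaMeasure a 1

theorem stdGamma_eq_withDensity (a : ℝ) :
    stdGamma a = (volume.restrict (Set.Ioi 0)).withDensity
      fun x => ENNReal.ofReal ((Real.Gamma a)⁻¹ * (Real.exp (-x) * x ^ (a - 1))) := by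
  have hpdf : ProbabilityTheory.gammaPDF a 1 = (Set.Ici 0).indicator
      fun x => ENNReal.ofReal ((Real.Gamma a)⁻¹ * (Real.exp (-x) * x ^ (a - 1))) := by
    ext x
    rcases le_or_gt 0 x with hx | hx
    · rw [Set.indicator_of_mem (Set.mem_Ici.2 hx), ProbabilityTheory.gammaPDF_of_nonneg hx,
        Real.one_rpow, one_mul, one_div]
      ring_nf
    · rw [Set.indicator_of_notMem (by simpa using hx), ProbabilityTheory.gammaPDF_of_neg hx]
  rw [stdGamma, ProbabilityTheory.gammaMeasure, hpdf, withDensity_indicator measurableSet_Ici,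
    restrict_Ioi_eq_restrict_Ici]

theorem ae_stdGamma_pos (a : ℝ) : ∀ᵐ x ∂stdGamma a, 0 < x := by
  rw [stdGamma_eq_withDensity]
  exact (withDensity_absolutelyContinuous _ _).ae_le (ae_restrict_mem measurableSet_Ioi)

theorem ae_stdGamma_nonneg (a : ℝ) : ∀ᵐ x ∂stdGamma a, 0 ≤ x :=
  (ae_stdGamma_pos a).mono fun _ => le_of_lt

theorem isProbabilityMeasure_stdGamma {a : ℝ} (ha : 0 < a) : IsProbabilityMeasure (stdGamma a) :=
  ProbabilityTheory.isProbabilityMeasure_gammaMeasure ha one_pos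

theorem powMoment_stdGamma {a : ℝ} (ha : 0 < a) {s : ℂ} (hs : 0 < s.re + a) :
    powMoment (stdGamma a) s = Complex.Gamma (s + a) / Complex.Gamma a := by
  rw [powMoment, stdGamma_eq_withDensity, integral_withDensity_eq_integral_toReal_smul
    (by fun_prop) (Filter.Eventually.of_forall fun x => ENNReal.ofReal_lt_top), div_eq_inv_mul,
    Complex.Gamma_eq_integral (s := s + a) (by simpa using hs), Complex.GammaIntegral,
    ← integral_const_mul]
  refine setIntegral_congr_fun measurableSet_Ioi fun x hx => ?_
  have hx : 0 < x := hx
  rw [ENNReal.toReal_ofReal (by positivity), Complex.real_smul, add_sub_assoc,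
    Complex.cpow_add _ _ (by exact_mod_cast hx.ne'), Complex.Gamma_ofReal]
  push_cast [Complex.ofReal_cpow hx.le]
  ring

theorem absMoment_stdGamma {a : ℝ} (ha : 0 < a) (s : ℂ) :
    absMoment (stdGamma a) s = ENNReal.ofReal (Real.Gamma a)⁻¹ *
      ∫⁻ x in Set.Ioi 0, ENNReal.ofReal (Real.exp (-x) * x ^ (s.re + a - 1)) := by
  rw [absMoment, stdGamma_eq_withDensity,
    lintegral_withDensity_eq_lintegral_mul _ (by fun_prop) (by fun_prop),
    ← lintegral_const_mul' _ _ ENNReal.ofReal_ne_top]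
  refine setLIntegral_congr_fun measurableSet_Ioi fun x hx => ?_
  have hx : 0 < x := hx
  rw [Pi.mul_apply, enorm_ofReal_cpow_of_pos hx, ← ENNReal.ofReal_mul (by positivity),
    ← ENNReal.ofReal_mul (by positivity), add_sub_assoc, Real.rpow_add hx]
  ring_nf

/-- Near `0` the factor `e⁻ˣ` is bounded below, so the divergence is that of `∫ x ^ (p - 1)`. -/
theorem integrableOn_exp_neg_mul_rpow_Ioi_iff {p : ℝ} :
    IntegrableOn (fun x => Real.exp (-x) * x ^ (p - 1)) (Set.Ioi 0) ↔ 0 < p := by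
  refine ⟨fun h => ?_, Real.GammaIntegral_convergent⟩
  have hpow : IntegrableOn (fun x : ℝ => x ^ (p - 1)) (Set.Ioo 0 1) := by
    refine ((h.mono_set Set.Ioo_subset_Ioi_self).const_mul (Real.exp 1)).mono'
      (by fun_prop) ((ae_restrict_iff' measurableSet_Ioo).2 (Filter.Eventually.of_forall ?_))
    intro x hx
    have hxp : 0 ≤ x ^ (p - 1) := Real.rpow_nonneg hx.1.le _
    rw [Real.norm_of_nonneg hxp, ← mul_assoc, ← Real.exp_add]
    exact le_mul_of_one_le_left hxp (Real.one_le_exp (by linarith [hx.2]))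
  rw [intervalIntegral.integrableOn_Ioo_rpow_iff one_pos] at hpow
  linarith

theorem absMoment_stdGamma_ne_top_iff {a : ℝ} (ha : 0 < a) (s : ℂ) :
    absMoment (stdGamma a) s ≠ ∞ ↔ 0 < s.re + a := by
  have hGamma : ENNReal.ofReal (Real.Gamma a)⁻¹ ≠ 0 := by simpa using Real.Gamma_pos_of_pos ha
  have hnonneg : 0 ≤ᵐ[volume.restrict (Set.Ioi 0)] fun x => Real.exp (-x) * x ^ (s.re + a - 1) :=
    (ae_restrict_mem measurableSet_Ioi).mono fun x (hx : 0 < x) => by positivity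
  rw [← integrableOn_exp_neg_mul_rpow_Ioi_iff, IntegrableOn,
    ← lintegral_ofReal_ne_top_iff_integrable (by fun_prop) hnonneg, absMoment_stdGamma ha, ne_eq,
    ENNReal.mul_eq_top]
  simp [hGamma]

theorem absMoment_stdGamma_ne_zero {a : ℝ} (ha : 0 < a) (s : ℂ) :
    absMoment (stdGamma a) s ≠ 0 := by
  have := isProbabilityMeasure_stdGamma ha
  refine absMoment_ne_zero ?_ s
  rw [(prob_compl_eq_zero_iff measurableSet_Ioi).1 (ae_stdGamma_pos a)]
  exact one_ne_zero

end StdGamma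

section Gaussian

theorem map_withDensity_comp {α β : Type*} [MeasurableSpace α] [MeasurableSpace β] (μ : Measure α)
    {f : α → β} (hf : Measurable f) {g : β → ℝ≥0∞} (hg : Measurable g) :
    (μ.withDensity (g ∘ f)).map f = (μ.map f).withDensity g := by
  ext u hu
  rw [Measure.map_apply hf hu, withDensity_apply _ (hf hu), withDensity_apply _ hu,
    setLIntegral_map hu hg hf]
  rfl

/-- The standard complex Gaussian distribution, normalized by `E|z|² = 1`. -/
def complexGaussian : Measure ℂ :=
  volume.withDensity fun z => ENNReal.ofReal (Real.pi⁻¹ * Real.exp (-‖z‖ ^ 2))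

theorem map_norm_sq_complexGaussian : complexGaussian.map (fun z => ‖z‖ ^ 2) = stdGamma 1 := by
  have hmap := map_withDensity_comp (volume : Measure ℂ) (f := fun z => ‖z‖ ^ 2) (by fun_prop)
    (g := fun x => ENNReal.ofReal (Real.pi⁻¹ * Real.exp (-x))) (by fun_prop)
  rw [map_norm_sq_volume_complex, withDensity_smul_measure,
    ← withDensity_smul _ (by fun_prop)] at hmap
  rw [complexGaussian, stdGamma_eq_withDensity]
  refine hmap.trans (congrArg _ (funext fun x => ?_))
  simp [← ENNReal.ofReal_mul Real.pi_nonneg, Real.pi_ne_zero]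

instance complexGaussian.instIsProbabilityMeasure : IsProbabilityMeasure complexGaussian := by
  have := isProbabilityMeasure_stdGamma one_pos
  rw [← map_norm_sq_complexGaussian] at this
  exact Measure.isProbabilityMeasure_of_map (fun z => ‖z‖ ^ 2)

/-- The distribution of a vector of independent standard complex Gaussians. -/
def gaussianVec (ι : Type*) [Fintype ι] : Measure (ι → ℂ) := Measure.pi fun _ => complexGaussian

variable (ι : Type*) [Fintype ι]

instance gaussianVec.instIsProbabilityMeasure : IsProbabilityMeasure (gaussianVec ι) := by
  unfold gaussianVec; infer_instance

theorem gaussianVec_eq_withDensity :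
    gaussianVec ι = volume.withDensity fun z =>
      ENNReal.ofReal (Real.pi⁻¹ ^ Fintype.card ι * Real.exp (-∑ i, ‖z i‖ ^ 2)) := by
  have : SigmaFinite ((volume : Measure ℂ).withDensity
      fun z => ENNReal.ofReal (Real.pi⁻¹ * Real.exp (-‖z‖ ^ 2))) :=
    inferInstanceAs (SigmaFinite complexGaussian)
  rw [gaussianVec]
  unfold complexGaussian
  rw [pi_withDensity_eq _ fun _ => by fun_prop, volume_pi]
  congr 1
  ext z
  rw [← ENNReal.ofReal_prod_of_nonneg fun i _ => by positivity, Finset.prod_mul_distrib,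
    ← Real.exp_sum]
  simp

end Gaussian

section Polar

/-- The squared Euclidean length of the vector `(1, z₁, …, zₙ)` lifting a point of the affine
chart. -/
def affineNormSq {n : ℕ} (z : Fin n → ℂ) : ℝ := 1 + ∑ i, ‖z i‖ ^ 2

theorem affineNormSq_pos {n : ℕ} (z : Fin n → ℂ) : 0 < affineNormSq z := by
  unfold affineNormSq; positivity

@[fun_prop]
theorem measurable_affineNormSq {n : ℕ} : Measurable (affineNormSq (n := n)) := by
  unfold affineNormSq; fun_prop

/-- The Fubini–Study volume form in the affine chart, normalized to have total mass one. -/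
def fsAffine (n : ℕ) : Measure (Fin n → ℂ) :=
  volume.withDensity fun z =>
    ENNReal.ofReal (n ! * Real.pi⁻¹ ^ n * (affineNormSq z ^ (n + 1))⁻¹)

instance fsAffine.instSFinite (n : ℕ) : SFinite (fsAffine n) := by
  unfold fsAffine; infer_instance

/-- The squared length and the affine coordinates of a vector of `ℂⁿ⁺¹`; the coordinates are
meaningful only when `a 0 ≠ 0`. -/
def lengthAndRatio (n : ℕ) (a : Fin (n + 1) → ℂ) : ℝ × (Fin n → ℂ) :=
  (∑ i, ‖a i‖ ^ 2, fun i => a i.succ / a 0)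

@[fun_prop]
theorem measurable_lengthAndRatio (n : ℕ) : Measurable (lengthAndRatio n) := by
  unfold lengthAndRatio; fun_prop

theorem lengthAndRatio_cons_smul {n : ℕ} {t : ℂ} (ht : t ≠ 0) (z : Fin n → ℂ) :
    lengthAndRatio n (Fin.cons t (t • z)) = (‖t‖ ^ 2 * affineNormSq z, z) := by
  unfold lengthAndRatio affineNormSq
  congr 1
  · simp [Fin.sum_univ_succ, mul_pow, Finset.mul_sum, mul_add]
  · ext i
    simp [ht]

theorem cons_smul_snd_lengthAndRatio {n : ℕ} {a : Fin (n + 1) → ℂ} (ha : a 0 ≠ 0) :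
    (Fin.cons (a 0) (a 0 • (lengthAndRatio n a).2) : Fin (n + 1) → ℂ) = a := by
  ext i
  refine Fin.cases rfl (fun i => ?_) i
  simp [lengthAndRatio, mul_div_cancel₀ _ ha]

theorem lintegral_eq_lintegral_cons_smul {n : ℕ} {G : (Fin (n + 1) → ℂ) → ℝ≥0∞}
    (hG : Measurable G) :
    ∫⁻ a, G a = ∫⁻ t : ℂ, ∫⁻ z : Fin n → ℂ,
      ENNReal.ofReal ((‖t‖ ^ 2) ^ n) * G (Fin.cons t (t • z)) := by
  have hcons := measurePreserving_finCons (n := n) fun _ => (volume : Measure ℂ)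
  have hG' : Measurable fun p : ℂ × (Fin n → ℂ) => G (Fin.cons p.1 p.2) :=
    hG.comp hcons.measurable
  rw [volume_pi, ← hcons.lintegral_comp hG, lintegral_prod _ hG'.aemeasurable]
  refine lintegral_congr_ae ?_
  filter_upwards [Measure.ae_ne volume (0 : ℂ)] with t ht
  rw [← volume_pi, lintegral_comp_complex_smul volume ht,
    ← lintegral_const_mul' _ _ ENNReal.ofReal_ne_top, Module.finrank_fin_fun]

/-- The measure `xⁿ dx` on `(0, ∞)`, the radial part in the squared length of Lebesgue measure on
`ℂⁿ⁺¹`. -/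
def radialMeasure (n : ℕ) : Measure ℝ :=
  (volume.restrict (Set.Ioi 0)).withDensity fun x => ENNReal.ofReal (x ^ n)

instance radialMeasure.instSFinite (n : ℕ) : SFinite (radialMeasure n) := by
  unfold radialMeasure; infer_instance

theorem lintegral_radialMeasure_comp_mul_left (n : ℕ) {b : ℝ} (hb : 0 < b) {h : ℝ → ℝ≥0∞}
    (hh : Measurable h) :
    ∫⁻ x, h (b * x) ∂radialMeasure n =
      ENNReal.ofReal (b ^ (n + 1))⁻¹ * ∫⁻ x, h x ∂radialMeasure n := by
  have hscale := lintegral_Ioi_comp_mul_left hb fun x => ENNReal.ofReal (x ^ n) * h x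
  rw [radialMeasure, lintegral_withDensity_eq_lintegral_mul _ (by fun_prop) (by fun_prop),
    lintegral_withDensity_eq_lintegral_mul _ (by fun_prop) hh]
  simp only [Pi.mul_apply]
  rw [hscale, ← mul_assoc, ← ENNReal.ofReal_mul (by positivity),
    ← lintegral_const_mul' _ _ ENNReal.ofReal_ne_top]
  refine lintegral_congr fun x => ?_
  rw [← mul_assoc, ← ENNReal.ofReal_mul (by positivity)]
  congr 2
  field_simp
  ring

theorem map_lengthAndRatio_volume (n : ℕ) :
    (volume : Measure (Fin (n + 1) → ℂ)).map (lengthAndRatio n) = (radialMeasure n).prod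
      (volume.withDensity fun z => ENNReal.ofReal (Real.pi * (affineNormSq z ^ (n + 1))⁻¹)) := by
  refine Measure.ext_of_lintegral _ fun F hF => ?_
  have hleft : ∫⁻ a, F (lengthAndRatio n a) = ∫⁻ t : ℂ, ∫⁻ z,
      ENNReal.ofReal ((‖t‖ ^ 2) ^ n) * F (affineNormSq z * ‖t‖ ^ 2, z) := by
    rw [lintegral_eq_lintegral_cons_smul (by fun_prop)]
    refine lintegral_congr_ae ?_
    filter_upwards [Measure.ae_ne volume (0 : ℂ)] with t ht
    simp only [lengthAndRatio_cons_smul ht, mul_comm (‖t‖ ^ 2)]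
  have hradial (z : Fin n → ℂ) :
      ∫⁻ t : ℂ, ENNReal.ofReal ((‖t‖ ^ 2) ^ n) * F (affineNormSq z * ‖t‖ ^ 2, z) =
        ENNReal.ofReal (Real.pi * (affineNormSq z ^ (n + 1))⁻¹) *
          ∫⁻ x, F (x, z) ∂radialMeasure n := by
    rw [← lintegral_map (f := fun x => ENNReal.ofReal (x ^ n) * F (affineNormSq z * x, z))
      (by fun_prop) (by fun_prop), map_norm_sq_volume_complex, lintegral_smul_measure,
      smul_eq_mul, ENNReal.ofReal_mul Real.pi_nonneg, mul_assoc,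
      ← lintegral_radialMeasure_comp_mul_left n (affineNormSq_pos z) (h := fun x => F (x, z))
        (by fun_prop), radialMeasure,
      lintegral_withDensity_eq_lintegral_mul _ (by fun_prop) (by fun_prop)]
    rfl
  rw [lintegral_map hF (by fun_prop), hleft, lintegral_lintegral_swap (by fun_prop),
    lintegral_prod_symm' _ hF,
    lintegral_withDensity_eq_lintegral_mul _ (by fun_prop) hF.lintegral_prod_left']
  exact lintegral_congr hradial

theorem stdGamma_eq_withDensity_radialMeasure (n : ℕ) :
    stdGamma (n + 1) =
      (radialMeasure n).withDensity fun x => ENNReal.ofReal ((n ! : ℝ)⁻¹ * Real.exp (-x)) := by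
  rw [stdGamma_eq_withDensity, radialMeasure, ← withDensity_mul _ (by fun_prop) (by fun_prop)]
  refine withDensity_congr_ae ?_
  filter_upwards [ae_restrict_mem measurableSet_Ioi] with x hx
  have hx : 0 < x := hx
  rw [Pi.mul_apply, ← ENNReal.ofReal_mul (by positivity), Real.Gamma_nat_eq_factorial,
    add_sub_cancel_right, Real.rpow_natCast]
  ring_nf

theorem map_lengthAndRatio_gaussianVec (n : ℕ) :
    (gaussianVec (Fin (n + 1))).map (lengthAndRatio n) =
      (stdGamma (n + 1)).prod (fsAffine n) := by
  have hgauss := map_withDensity_comp volume (measurable_lengthAndRatio n)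
    (g := fun p => ENNReal.ofReal (Real.pi⁻¹ ^ (n + 1) * Real.exp (-p.1))) (by fun_prop)
  rw [map_lengthAndRatio_volume, prod_withDensity_right (by fun_prop),
    ← withDensity_mul _ (by fun_prop) (by fun_prop)] at hgauss
  rw [gaussianVec_eq_withDensity, Fintype.card_fin, stdGamma_eq_withDensity_radialMeasure,
    fsAffine, prod_withDensity (by fun_prop) (by fun_prop)]
  refine hgauss.trans (congrArg _ (funext fun p => ?_))
  have := affineNormSq_pos p.2
  rw [Pi.mul_apply, ← ENNReal.ofReal_mul (by positivity), ← ENNReal.ofReal_mul (by positivity)]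
  congr 1
  rw [pow_succ Real.pi⁻¹]
  field_simp

instance fsAffine.instIsProbabilityMeasure (n : ℕ) : IsProbabilityMeasure (fsAffine n) := by
  have := isProbabilityMeasure_stdGamma (a := n + 1) (by positivity)
  have h := congrArg (fun μ => μ Set.univ) (map_lengthAndRatio_gaussianVec n)
  simp only [Measure.map_apply (measurable_lengthAndRatio n) MeasurableSet.univ,
    Set.preimage_univ, measure_univ] at h
  rw [← Set.univ_prod_univ, Measure.prod_prod, measure_univ, one_mul] at h
  exact ⟨h.symm⟩

theorem map_length_gaussianVec (n : ℕ) :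
    (gaussianVec (Fin (n + 1))).map (fun a => ∑ i, ‖a i‖ ^ 2) = stdGamma (n + 1) := by
  have h := congrArg Measure.fst (map_lengthAndRatio_gaussianVec n)
  rwa [Measure.fst_prod, Measure.fst, Measure.map_map (by fun_prop) (by fun_prop)] at h

end Polar

section Unitary

variable {ι : Type*} [Fintype ι] [DecidableEq ι] {U : Matrix ι ι ℂ}

theorem norm_det_of_mem_unitaryGroup (hU : U ∈ unitaryGroup ι ℂ) : ‖U.det‖ = 1 :=
  CStarRing.norm_of_mem_unitary (det_of_mem_unitary hU)

theorem sum_norm_sq_mulVec_of_mem_unitaryGroup (hU : U ∈ unitaryGroup ι ℂ) (v : ι → ℂ) :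
    ∑ i, ‖(U *ᵥ v) i‖ ^ 2 = ∑ i, ‖v i‖ ^ 2 := by
  have hsum (w : ι → ℂ) : ((∑ i, ‖w i‖ ^ 2 : ℝ) : ℂ) = star w ⬝ᵥ w := by
    simp [dotProduct, Complex.conj_mul']
  have hinner : star (U *ᵥ v) ⬝ᵥ (U *ᵥ v) = star v ⬝ᵥ v := by
    rw [star_mulVec, ← dotProduct_mulVec, mulVec_mulVec, ← star_eq_conjTranspose,
      mem_unitaryGroup_iff'.1 hU, one_mulVec]
  exact_mod_cast (hsum _).trans (hinner.trans (hsum _).symm)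

theorem measurePreserving_mulVec_gaussianVec (hU : U ∈ unitaryGroup ι ℂ) :
    MeasurePreserving (fun v => U *ᵥ v) (gaussianVec ι) (gaussianVec ι) := by
  have hmeas : Measurable fun v : ι → ℂ => U *ᵥ v :=
    (toLin' U).continuous_of_finiteDimensional.measurable
  have hvolume : (volume : Measure (ι → ℂ)).map (fun v => U *ᵥ v) = volume := by
    have hdet := norm_det_of_mem_unitaryGroup hU
    have h := map_complex_linearMap_addHaar (volume : Measure (ι → ℂ)) (f := toLin' U) (by
      rw [LinearMap.det_toLin', ← norm_ne_zero_iff, hdet]; exact one_ne_zero)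
    simpa [hdet] using! h
  refine ⟨hmeas, ?_⟩
  have h := map_withDensity_comp volume hmeas (g := fun v => ENNReal.ofReal
    (Real.pi⁻¹ ^ Fintype.card ι * Real.exp (-∑ i, ‖v i‖ ^ 2))) (by fun_prop)
  simpa only [Function.comp_def, sum_norm_sq_mulVec_of_mem_unitaryGroup hU,
    ← gaussianVec_eq_withDensity, hvolume] using h

theorem exists_unitary_mulVec_eq_single (a : ι → ℂ) (i₀ : ι) :
    ∃ U ∈ unitaryGroup ι ℂ, U *ᵥ a = Pi.single i₀ (‖WithLp.toLp 2 a‖ : ℂ) := by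
  set v : EuclideanSpace ℂ ι := WithLp.toLp 2 a with hv
  rcases eq_or_ne a 0 with rfl | ha
  · exact ⟨1, one_mem _, by simp [hv]⟩
  have hv0 : (‖v‖ : ℂ) ≠ 0 := by simpa [hv] using ha
  have hunit : Orthonormal ℂ (({i₀} : Set ι).domRestrict fun _ => (‖v‖ : ℂ)⁻¹ • v) :=
    ⟨fun _ => by simpa [norm_smul] using inv_mul_cancel₀ (by exact_mod_cast hv0 : ‖v‖ ≠ 0),
      fun i j hij => absurd (Subsingleton.elim i j) hij⟩
  obtain ⟨b, hb⟩ := hunit.exists_orthonormalBasis_extension_of_card_eq (by simp)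
  have hvb : v = (‖v‖ : ℂ) • b i₀ := by
    rw [hb i₀ rfl, smul_smul, mul_inv_cancel₀ hv0, one_smul]
  refine ⟨_, b.toMatrix_orthonormalBasis_mem_unitary (EuclideanSpace.basisFun ι ℂ), ?_⟩
  have hrepr := (EuclideanSpace.basisFun ι ℂ).toBasis.toMatrix_mulVec_repr b.toBasis v
  have hsingle : ⇑(b.toBasis.repr v) = Pi.single i₀ (‖v‖ : ℂ) := by
    conv_lhs => rw [hvb]
    ext j
    simp [-Complex.coe_smul, Pi.single_apply]
  rw [hsingle] at hrepr
  exact hrepr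

theorem norm_det_of_mulVec (hU : U ∈ unitaryGroup ι ℂ) (A : ι → ι → ℂ) :
    ‖(Matrix.of fun i => U *ᵥ A i).det‖ = ‖(Matrix.of A).det‖ := by
  have hmul : (Matrix.of fun i => U *ᵥ A i) = Matrix.of A * Uᵀ := by
    ext i j
    simp [mul_apply, mulVec, dotProduct, mul_comm]
  rw [hmul, det_mul, det_transpose, norm_mul, norm_det_of_mem_unitaryGroup hU, mul_one]

end Unitary

section Ginibre

/-- The Ginibre ensemble: the distribution of an `N × N` matrix of independent standard complex
Gaussians. -/
def ginibre (N : ℕ) : Measure (Fin N → Fin N → ℂ) := Measure.pi fun _ => gaussianVec (Fin N)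

instance ginibre.instIsProbabilityMeasure (N : ℕ) : IsProbabilityMeasure (ginibre N) := by
  unfold ginibre; infer_instance

theorem ginibre_eq_withDensity (N : ℕ) :
    ginibre N = volume.withDensity fun A =>
      ENNReal.ofReal (Real.pi⁻¹ ^ N ^ 2 * Real.exp (-∑ i, ∑ j, ‖A i j‖ ^ 2)) := by
  have hgauss := gaussianVec_eq_withDensity (Fin N)
  have : SigmaFinite ((volume : Measure (Fin N → ℂ)).withDensity fun z =>
      ENNReal.ofReal (Real.pi⁻¹ ^ Fintype.card (Fin N) * Real.exp (-∑ i, ‖z i‖ ^ 2))) := by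
    rw [← hgauss]; infer_instance
  simp only [ginibre, hgauss]
  rw [pi_withDensity_eq _ fun _ => by fun_prop, ← volume_pi]
  congr 1
  ext A
  rw [← ENNReal.ofReal_prod_of_nonneg fun i _ => by positivity, Finset.prod_mul_distrib,
    ← Real.exp_sum]
  simp [pow_two, pow_mul]

/-- The distribution of `|det A|²` for a Ginibre matrix `A`. -/
def detLaw (N : ℕ) : Measure ℝ := (ginibre N).map fun A => ‖(Matrix.of A).det‖ ^ 2

@[fun_prop]
theorem measurable_norm_det_sq (N : ℕ) :
    Measurable fun A : Fin N → Fin N → ℂ => ‖(Matrix.of A).det‖ ^ 2 := by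
  have : Continuous fun A : Fin N → Fin N → ℂ => (Matrix.of A).det :=
    Continuous.matrix_det continuous_id
  exact (this.norm.pow 2).measurable

instance detLaw.instIsProbabilityMeasure (N : ℕ) : IsProbabilityMeasure (detLaw N) :=
  Measure.isProbabilityMeasure_map (measurable_norm_det_sq N).aemeasurable

theorem ae_detLaw_nonneg (N : ℕ) : ∀ᵐ x ∂detLaw N, 0 ≤ x := by
  rw [detLaw, ae_map_iff (measurable_norm_det_sq N).aemeasurable measurableSet_Ici]
  exact Filter.Eventually.of_forall fun _ => by positivity

theorem detLaw_zero : detLaw 0 = Measure.dirac 1 := by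
  simp [detLaw, det_fin_zero, Measure.map_const]

theorem det_of_cons_single {R : Type*} [CommRing R] {N : ℕ} (c : R)
    (B : Fin N → Fin (N + 1) → R) :
    (Matrix.of (Fin.cons (Pi.single 0 c) B : Fin (N + 1) → Fin (N + 1) → R)).det =
      c * (Matrix.of fun i j => B i j.succ).det := by
  rw [det_succ_row_zero, Fin.sum_univ_succ]
  simp only [of_apply, Fin.cons_zero, Pi.single_apply, Fin.succ_ne_zero, if_true, if_false,
    Fin.val_zero, pow_zero, one_mul, mul_zero, zero_mul, Finset.sum_const_zero, add_zero]
  rfl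

theorem norm_det_of_cons_of_mulVec_eq_single {N : ℕ} {U : Matrix (Fin (N + 1)) (Fin (N + 1)) ℂ}
    (hU : U ∈ unitaryGroup (Fin (N + 1)) ℂ) {a : Fin (N + 1) → ℂ} {c : ℂ}
    (hUa : U *ᵥ a = Pi.single 0 c) (B : Fin N → Fin (N + 1) → ℂ) :
    ‖(Matrix.of (Fin.cons a B : Fin (N + 1) → Fin (N + 1) → ℂ)).det‖ =
      ‖c‖ * ‖(Matrix.of fun i j => (U *ᵥ B i) (Fin.succ j)).det‖ := by
  have hcons : (fun i => U *ᵥ (Fin.cons a B : Fin (N + 1) → Fin (N + 1) → ℂ) i) =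
      Fin.cons (Pi.single 0 c) fun i => U *ᵥ B i := by
    ext i : 1
    refine Fin.cases ?_ (fun i => ?_) i <;> simp [hUa]
  rw [← norm_det_of_mulVec hU, hcons, det_of_cons_single, norm_mul]

theorem measurePreserving_tail_gaussianVec (N : ℕ) :
    MeasurePreserving (fun (v : Fin (N + 1) → ℂ) (j : Fin N) => v j.succ)
      (gaussianVec (Fin (N + 1))) (gaussianVec (Fin N)) :=
  measurePreserving_snd.comp
    (measurePreserving_piFinSuccAbove (fun _ : Fin (N + 1) => complexGaussian) 0)

theorem lintegral_norm_det_of_cons {N : ℕ} (a : Fin (N + 1) → ℂ) {g : ℝ → ℝ≥0∞}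
    (hg : Measurable g) :
    ∫⁻ B, g (‖(Matrix.of (Fin.cons a B : Fin (N + 1) → Fin (N + 1) → ℂ)).det‖ ^ 2)
        ∂(Measure.pi fun _ : Fin N => gaussianVec (Fin (N + 1))) =
      ∫⁻ y, g ((∑ i, ‖a i‖ ^ 2) * y) ∂detLaw N := by
  obtain ⟨U, hU, hUa⟩ := exists_unitary_mulVec_eq_single a 0
  have hpres := measurePreserving_pi (fun _ : Fin N => gaussianVec (Fin (N + 1)))
    (fun _ : Fin N => gaussianVec (Fin N)) fun _ =>
      (measurePreserving_tail_gaussianVec N).comp (measurePreserving_mulVec_gaussianVec hU)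
  rw [detLaw, lintegral_map (by fun_prop) (by fun_prop), ginibre,
    ← hpres.lintegral_comp (by fun_prop)]
  refine lintegral_congr fun B => congrArg g ?_
  rw [norm_det_of_cons_of_mulVec_eq_single hU hUa, mul_pow, Complex.norm_real, norm_norm,
    EuclideanSpace.norm_sq_eq]
  rfl

theorem detLaw_succ (N : ℕ) : detLaw (N + 1) = stdGamma (N + 1) ∗ₘ detLaw N := by
  refine Measure.ext_of_lintegral _ fun g hg => ?_
  have hcons := measurePreserving_finCons fun _ : Fin (N + 1) => gaussianVec (Fin (N + 1))
  have hmeas : Measurable fun p : (Fin (N + 1) → ℂ) × (Fin N → Fin (N + 1) → ℂ) =>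
      g (‖(Matrix.of (Fin.cons p.1 p.2 : Fin (N + 1) → Fin (N + 1) → ℂ)).det‖ ^ 2) :=
    (hg.comp (measurable_norm_det_sq (N + 1))).comp hcons.measurable
  rw [Measure.lintegral_mconv hg, ← map_length_gaussianVec, lintegral_map (by fun_prop)
    (by fun_prop), detLaw, lintegral_map hg (by fun_prop), ginibre,
    ← hcons.lintegral_comp (by fun_prop), lintegral_prod _ hmeas.aemeasurable]
  exact lintegral_congr fun a => lintegral_norm_det_of_cons a hg

end Ginibre

section Slater

/-- The squared Fubini–Study norm of the Slater determinant of the homogeneous coordinates, in the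
affine chart. -/
def slaterSq (n : ℕ) (z : Fin (n + 1) → Fin n → ℂ) : ℝ :=
  ‖(Matrix.of fun j => (Fin.cons 1 (z j) : Fin (n + 1) → ℂ)).det‖ ^ 2 / ∏ j, affineNormSq (z j)

@[fun_prop]
theorem measurable_slaterSq (n : ℕ) : Measurable (slaterSq n) := by
  have hrows : Measurable fun (z : Fin (n + 1) → Fin n → ℂ) (j : Fin (n + 1)) =>
      (Fin.cons 1 (z j) : Fin (n + 1) → ℂ) := by
    refine measurable_pi_lambda _ fun j => measurable_pi_lambda _ fun i => ?_
    refine Fin.cases measurable_const (fun i => ?_) i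
    simp only [Fin.cons_succ]
    fun_prop
  exact ((measurable_norm_det_sq (n + 1)).comp hrows).div (by fun_prop)

theorem slaterSq_nonneg (n : ℕ) (z : Fin (n + 1) → Fin n → ℂ) : 0 ≤ slaterSq n z :=
  div_nonneg (by positivity) (Finset.prod_nonneg fun j _ => (affineNormSq_pos (z j)).le)

theorem norm_det_of_cons_smul {n : ℕ} (t : Fin (n + 1) → ℂ) (z : Fin (n + 1) → Fin n → ℂ) :
    ‖(Matrix.of fun j => (Fin.cons (t j) (t j • z j) : Fin (n + 1) → ℂ)).det‖ ^ 2 =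
      (∏ j, ‖t j‖ ^ 2 * affineNormSq (z j)) * slaterSq n z := by
  have hscale : (Matrix.of fun j => (Fin.cons (t j) (t j • z j) : Fin (n + 1) → ℂ)) =
      Matrix.of fun j i => t j * (Matrix.of fun j => (Fin.cons 1 (z j) : Fin (n + 1) → ℂ)) j i := by
    ext j i
    refine Fin.cases ?_ (fun i => ?_) i <;> simp
  have hpos : ∏ j, affineNormSq (z j) ≠ 0 :=
    Finset.prod_ne_zero_iff.2 fun j _ => (affineNormSq_pos (z j)).ne'
  rw [hscale, det_mul_column, norm_mul, norm_prod, mul_pow, slaterSq, Finset.prod_mul_distrib,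
    Finset.prod_pow]
  field_simp

theorem norm_det_sq_eq_prod_mul_slaterSq {n : ℕ} {A : Fin (n + 1) → Fin (n + 1) → ℂ}
    (hA : ∀ j, A j 0 ≠ 0) :
    ‖(Matrix.of A).det‖ ^ 2 =
      (∏ j, (lengthAndRatio n (A j)).1) * slaterSq n fun j => (lengthAndRatio n (A j)).2 := by
  have hrow (j : Fin (n + 1)) := cons_smul_snd_lengthAndRatio (hA j)
  have hlength (j : Fin (n + 1)) : (lengthAndRatio n (A j)).1 =
      ‖A j 0‖ ^ 2 * affineNormSq (lengthAndRatio n (A j)).2 := by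
    have h := lengthAndRatio_cons_smul (hA j) (lengthAndRatio n (A j)).2
    rw [hrow j] at h
    exact congrArg Prod.fst h
  simp only [hlength, ← norm_det_of_cons_smul, hrow]

theorem ae_ginibre_apply_ne_zero (n : ℕ) : ∀ᵐ A ∂ginibre (n + 1), ∀ j, A j 0 ≠ 0 := by
  have hentry : ∀ᵐ z ∂complexGaussian, z ≠ 0 :=
    (withDensity_absolutelyContinuous _ _).ae_le (Measure.ae_ne volume 0)
  have hrow : ∀ᵐ a ∂gaussianVec (Fin (n + 1)), a 0 ≠ 0 :=
    (Measure.quasiMeasurePreserving_eval (fun _ : Fin (n + 1) => complexGaussian) 0).ae hentry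
  exact ae_all_iff.2 fun j => (Measure.quasiMeasurePreserving_eval
    (fun _ : Fin (n + 1) => gaussianVec (Fin (n + 1))) j).ae hrow

/-- The distribution of the squared norm of the Slater determinant at independent points
distributed according to the normalized Fubini–Study volume. -/
def slaterLaw (n : ℕ) : Measure ℝ :=
  (Measure.pi fun _ : Fin (n + 1) => fsAffine n).map (slaterSq n)

instance slaterLaw.instIsProbabilityMeasure (n : ℕ) : IsProbabilityMeasure (slaterLaw n) :=
  Measure.isProbabilityMeasure_map (measurable_slaterSq n).aemeasurable

theorem ae_slaterLaw_nonneg (n : ℕ) : ∀ᵐ x ∂slaterLaw n, 0 ≤ x := by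
  rw [slaterLaw, ae_map_iff (measurable_slaterSq n).aemeasurable measurableSet_Ici]
  exact Filter.Eventually.of_forall (slaterSq_nonneg n)

theorem detLaw_eq_prodLaw_mconv_slaterLaw (n : ℕ) :
    detLaw (n + 1) = prodLaw (fun _ : Fin (n + 1) => stdGamma (n + 1)) ∗ₘ slaterLaw n := by
  have := isProbabilityMeasure_stdGamma (a := n + 1) (by positivity)
  have hpres := (measurePreserving_arrowProdEquivProdArrow ℝ (Fin n → ℂ) (Fin (n + 1))
    (fun _ => stdGamma (n + 1)) fun _ => fsAffine n).comp
    (measurePreserving_pi (fun _ : Fin (n + 1) => gaussianVec (Fin (n + 1)))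
      (fun _ : Fin (n + 1) => (stdGamma (n + 1)).prod (fsAffine n)) fun _ =>
      ⟨measurable_lengthAndRatio n, map_lengthAndRatio_gaussianVec n⟩)
  refine Measure.ext_of_lintegral _ fun g hg => ?_
  rw [Measure.mconv, prodLaw, slaterLaw, Measure.map_prod_map _ _ (by fun_prop) (by fun_prop),
    lintegral_map hg (by fun_prop), lintegral_map (by fun_prop) (by fun_prop),
    ← hpres.lintegral_comp (by fun_prop), detLaw, lintegral_map hg (by fun_prop)]
  refine lintegral_congr_ae ?_
  filter_upwards [ae_ginibre_apply_ne_zero n] with A hA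
  rw [norm_det_sq_eq_prod_mul_slaterSq hA]
  rfl

end Slater

section Moments

theorem absMoment_detLaw (N : ℕ) (s : ℂ) :
    absMoment (detLaw N) s = ∏ k ∈ Finset.range N, absMoment (stdGamma (k + 1)) s := by
  induction N with
  | zero => simp [detLaw_zero, absMoment]
  | succ N ih =>
    have := isProbabilityMeasure_stdGamma (a := N + 1) (by positivity)
    rw [detLaw_succ, absMoment_mconv (ae_stdGamma_nonneg _) (ae_detLaw_nonneg N), ih,
      Finset.prod_range_succ, mul_comm]

theorem powMoment_detLaw (N : ℕ) {s : ℂ} (hs : -1 < s.re) :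
    powMoment (detLaw N) s = ∏ k ∈ Finset.range N, Complex.Gamma (s + k + 1) / k ! := by
  induction N with
  | zero => simp [detLaw_zero, powMoment]
  | succ N ih =>
    have hN : (0 : ℝ) < N + 1 := by positivity
    have := isProbabilityMeasure_stdGamma hN
    rw [detLaw_succ, powMoment_mconv (ae_stdGamma_nonneg _) (ae_detLaw_nonneg N), ih,
      Finset.prod_range_succ, mul_comm, powMoment_stdGamma hN (by linarith)]
    simp [Complex.Gamma_nat_eq_factorial, add_assoc]

theorem absMoment_detLaw_succ_ne_top_iff (N : ℕ) (s : ℂ) :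
    absMoment (detLaw (N + 1)) s ≠ ∞ ↔ -1 < s.re := by
  rw [absMoment_detLaw]
  constructor
  · contrapose
    intro hs
    rw [Finset.prod_range_succ', ENNReal.mul_eq_top]
    refine Or.inl ⟨Finset.prod_ne_zero_iff.2 fun k _ =>
      absMoment_stdGamma_ne_zero (by positivity) s, ?_⟩
    rw [← not_ne_iff, absMoment_stdGamma_ne_top_iff (by positivity)]
    push_cast
    linarith
  · intro hs
    refine ENNReal.prod_ne_top fun k _ =>
      (absMoment_stdGamma_ne_top_iff (by positivity) s).2 ?_
    linarith [(k.cast_nonneg : (0 : ℝ) ≤ k)]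

theorem absMoment_detLaw_eq_mul_slaterLaw (n : ℕ) (s : ℂ) :
    absMoment (detLaw (n + 1)) s =
      absMoment (stdGamma (n + 1)) s ^ (n + 1) * absMoment (slaterLaw n) s := by
  have := isProbabilityMeasure_stdGamma (a := n + 1) (by positivity)
  rw [detLaw_eq_prodLaw_mconv_slaterLaw,
    absMoment_mconv (ae_prodLaw_nonneg fun _ => ae_stdGamma_nonneg _) (ae_slaterLaw_nonneg n),
    absMoment_prodLaw fun _ => ae_stdGamma_nonneg _]
  simp

theorem powMoment_detLaw_eq_mul_slaterLaw (n : ℕ) (s : ℂ) :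
    powMoment (detLaw (n + 1)) s =
      powMoment (stdGamma (n + 1)) s ^ (n + 1) * powMoment (slaterLaw n) s := by
  have := isProbabilityMeasure_stdGamma (a := n + 1) (by positivity)
  rw [detLaw_eq_prodLaw_mconv_slaterLaw,
    powMoment_mconv (ae_prodLaw_nonneg fun _ => ae_stdGamma_nonneg _) (ae_slaterLaw_nonneg n),
    powMoment_prodLaw fun _ => ae_stdGamma_nonneg _]
  simp

theorem absMoment_slaterLaw_ne_top_iff {n : ℕ} (hn : 1 ≤ n) (s : ℂ) :
    absMoment (slaterLaw n) s ≠ ∞ ↔ -1 < s.re := by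
  have hn' : (0 : ℝ) < n + 1 := by positivity
  constructor
  · intro h
    by_contra hs
    have hslater : absMoment (slaterLaw n) (-1) ≠ ∞ :=
      absMoment_ne_top_of_re_le (ae_slaterLaw_nonneg n) (by simpa using hs) (by simp) h
    have hlength : absMoment (stdGamma (n + 1)) (-1) ≠ ∞ :=
      (absMoment_stdGamma_ne_top_iff hn' _).2 <| by
        simpa [pos_iff_ne_zero, ← Nat.one_le_iff_ne_zero] using hn
    have hdet := (absMoment_detLaw_succ_ne_top_iff n (-1)).1 <| by
      rw [absMoment_detLaw_eq_mul_slaterLaw]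
      exact ENNReal.mul_ne_top (ENNReal.pow_ne_top hlength) hslater
    simp at hdet
  · intro hs h
    refine (absMoment_detLaw_succ_ne_top_iff n s).2 hs ?_
    rw [absMoment_detLaw_eq_mul_slaterLaw, h, ENNReal.mul_top]
    exact pow_ne_zero _ (absMoment_stdGamma_ne_zero hn' s)

end Moments

section AffineChart

theorem CPn.isQuotientMap_mk (n : ℕ) : Topology.IsQuotientMap
    fun v : {v : EuclideanSpace ℂ (Fin (n + 1)) // v ≠ 0} => Projectivization.mk ℂ v.1 v.2 :=
  ⟨⟨rfl⟩, fun x => ⟨⟨x.rep, x.rep_nonzero⟩, x.mk_rep⟩⟩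

theorem continuous_affineChart (n : ℕ) : Continuous (affineChart n) := by
  have hvec : Continuous (affineVec n) :=
    (PiLp.continuous_toLp 2 _).comp (continuous_const.finCons continuous_id)
  exact (CPn.isQuotientMap_mk n).continuous.comp (hvec.subtype_mk (affineVec_ne_zero n))

/-- The affine coordinates `Zᵢ / Z₀` of a point of `ℙⁿ`, with value `0` on the hyperplane
`Z₀ = 0`. -/
def affineCoord (n : ℕ) (x : CPn n) : Fin n → ℂ := fun i => x.rep i.succ / x.rep 0

theorem affineCoord_mk {n : ℕ} (v : EuclideanSpace ℂ (Fin (n + 1))) (hv : v ≠ 0) :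
    affineCoord n (Projectivization.mk ℂ v hv) = fun i => v i.succ / v 0 := by
  obtain ⟨a, ha⟩ := Projectivization.exists_smul_eq_mk_rep ℂ v hv
  ext i
  rw [affineCoord, ← ha]
  exact mul_div_mul_left _ _ a.ne_zero

theorem leftInverse_affineCoord (n : ℕ) :
    Function.LeftInverse (affineCoord n) (affineChart n) := by
  intro z
  rw [affineChart, affineCoord_mk]
  simp [affineVec]

theorem affineChart_eq_mk_iff {n : ℕ} {z : Fin n → ℂ} {v : EuclideanSpace ℂ (Fin (n + 1))}
    (hv : v ≠ 0) :
    affineChart n z = Projectivization.mk ℂ v hv ↔ v 0 ≠ 0 ∧ z = fun i => v i.succ / v 0 := by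
  constructor
  · intro h
    refine ⟨fun h0 => ?_, ?_⟩
    · obtain ⟨a, ha⟩ := (Projectivization.mk_eq_mk_iff' ℂ _ _ (affineVec_ne_zero n z) hv).1 h
      simpa [h0, affineVec] using congrArg (fun w : EuclideanSpace ℂ (Fin (n + 1)) => w 0) ha
    · rw [← affineCoord_mk v hv, ← h, leftInverse_affineCoord]
  · rintro ⟨h0, rfl⟩
    refine (Projectivization.mk_eq_mk_iff' ℂ _ _ _ hv).2 ⟨(v 0)⁻¹, ?_⟩
    ext i
    refine Fin.cases ?_ (fun i => ?_) i
    · simp [affineVec, h0]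
    · simp [affineVec, div_eq_inv_mul]

theorem isOpenMap_affineChart (n : ℕ) : IsOpenMap (affineChart n) := by
  intro V hV
  rw [← (CPn.isQuotientMap_mk n).isOpen_preimage]
  have hpre : (fun v : {v : EuclideanSpace ℂ (Fin (n + 1)) // v ≠ 0} =>
      Projectivization.mk ℂ v.1 v.2) ⁻¹' (affineChart n '' V) =
      {v | v.1 0 ≠ 0} ∩ (fun v i => v.1 (Fin.succ i) / v.1 0) ⁻¹' V := by
    ext v
    simp only [Set.mem_preimage, Set.mem_image, affineChart_eq_mk_iff v.2, Set.mem_inter_iff,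
      Set.mem_ofPred_eq]
    exact ⟨fun ⟨_, hz, h0, h⟩ => ⟨h0, h ▸ hz⟩, fun ⟨h0, hz⟩ => ⟨_, hz, h0, rfl⟩⟩
  rw [hpre]
  refine ContinuousOn.isOpen_inter_preimage ?_ (isOpen_ne_fun (by fun_prop) continuous_const) hV
  exact continuousOn_pi.2 fun i => ContinuousOn.div (Continuous.continuousOn (by fun_prop))
    (Continuous.continuousOn (by fun_prop)) fun v hv => hv

theorem measurableEmbedding_affineChart (n : ℕ) : MeasurableEmbedding (affineChart n) :=
  (Topology.IsOpenEmbedding.of_continuous_injective_isOpenMap (continuous_affineChart n)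
    (leftInverse_affineCoord n).injective (isOpenMap_affineChart n)).measurableEmbedding

theorem measurableEmbedding_pi_affineChart (n : ℕ) (ι : Type*) [Countable ι] :
    MeasurableEmbedding (Pi.map fun _ : ι => affineChart n) :=
  measurableEmbedding_pi fun _ => measurableEmbedding_affineChart n

end AffineChart

section PartitionFunction

/-- The total mass `πⁿ / n!` of the Fubini–Study volume form. -/
def fsMass (n : ℕ) : ℝ := (n ! * Real.pi⁻¹ ^ n)⁻¹

theorem fsMass_pos (n : ℕ) : 0 < fsMass n := by
  unfold fsMass
  positivity

theorem fsVolume_eq_map (n : ℕ) :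
    fsVolume n = (ENNReal.ofReal (fsMass n) • fsAffine n).map (affineChart n) := by
  have hne : (n ! * Real.pi⁻¹ ^ n : ℝ) ≠ 0 := by positivity
  rw [fsVolume, fsAffine, ← withDensity_smul _ (by fun_prop)]
  congr 2
  ext z
  rw [Pi.smul_apply, smul_eq_mul, ← ENNReal.ofReal_mul (fsMass_pos n).le, fsMass,
    inv_mul_cancel_left₀ hne, affineNormSq]

theorem pi_fsVolume_eq_smul_map (n : ℕ) (ι : Type*) [Fintype ι] :
    (Measure.pi fun _ : ι => fsVolume n) =
      ENNReal.ofReal (fsMass n ^ Fintype.card ι) • (Measure.pi fun _ : ι => fsAffine n).map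
        (Pi.map fun _ => affineChart n) := by
  have hfin : IsFiniteMeasure (ENNReal.ofReal (fsMass n) • fsAffine n) :=
    Measure.smul_finite _ ENNReal.ofReal_ne_top
  simp only [fsVolume_eq_map]
  rw [ENNReal.ofReal_pow (fsMass_pos n).le, ← Measure.map_smul, ← pi_const_smul_eq]
  exact (Measure.pi_map_pi fun _ =>
    (measurableEmbedding_affineChart n).measurable.aemeasurable).symm

theorem ofReal_cpow_two_mul {t : ℝ} (ht : 0 ≤ t) (w : ℂ) :
    (t : ℂ) ^ (2 * w) = ((t ^ 2 : ℝ) : ℂ) ^ w := by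
  rw [sq, Complex.ofReal_mul, Complex.mul_cpow_ofReal_nonneg ht ht, ← sq]
  exact_mod_cast Complex.cpow_nat_mul (t : ℂ) 2 w

theorem norm_sq_affineVec (n : ℕ) (z : Fin n → ℂ) : ‖affineVec n z‖ ^ 2 = affineNormSq z := by
  rw [EuclideanSpace.norm_sq_eq, Fin.sum_univ_succ]
  simp [affineVec, affineNormSq]

theorem slaterNorm_affineChart_sq (n : ℕ) (z : Fin (n + 1) → Fin n → ℂ) :
    slaterNorm (coordSection n) (Pi.map (fun _ => affineChart n) z) ^ 2 = slaterSq n z := by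
  have htranspose : (Matrix.of fun i j => coordSection n i (affineVec n (z j))) =
      (Matrix.of fun j => (Fin.cons 1 (z j) : Fin (n + 1) → ℂ))ᵀ := rfl
  change slaterNorm _ (fun j => Projectivization.mk ℂ (affineVec n (z j)) _) ^ 2 = _
  rw [slaterNorm_mk, htranspose, det_transpose, div_pow, ← Finset.prod_pow, slaterSq]
  simp only [norm_sq_affineVec]

theorem partitionIntegrand_affineChart (n : ℕ) (β : ℂ) (z : Fin (n + 1) → Fin n → ℂ) :
    partitionIntegrand n β (Pi.map (fun _ => affineChart n) z) =
      (slaterSq n z : ℂ) ^ (β * (n + 1)) := by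
  have hexponent : 2 * β / minLevel n = 2 * (β * (n + 1)) := by
    rw [minLevel, div_div_eq_mul_div, div_one, mul_assoc]
  rw [partitionIntegrand, hexponent, ofReal_cpow_two_mul (by unfold slaterNorm; positivity),
    slaterNorm_affineChart_sq]

theorem integrable_partitionIntegrand_iff_absMoment_ne_top (n : ℕ) (β : ℂ) :
    Integrable (partitionIntegrand n β) (Measure.pi fun _ : Fin (n + 1) => fsVolume n) ↔
      absMoment (slaterLaw n) (β * (n + 1)) ≠ ∞ := by
  rw [pi_fsVolume_eq_smul_map, integrable_smul_measure
    (by simpa using pow_pos (fsMass_pos n) _) ENNReal.ofReal_ne_top,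
    (measurableEmbedding_pi_affineChart n _).integrable_map_iff,
    ← integrable_cpow_iff_absMoment_ne_top, slaterLaw,
    integrable_map_measure (measurable_ofReal_cpow_const _).aestronglyMeasurable (by fun_prop)]
  simp only [Function.comp_def, partitionIntegrand_affineChart]

theorem partitionFunction_eq_powMoment (n : ℕ) (β : ℂ) :
    partitionFunction n β =
      (fsMass n ^ (n + 1) : ℝ) * powMoment (slaterLaw n) (β * (n + 1)) := by
  rw [partitionFunction, pi_fsVolume_eq_smul_map, integral_smul_measure,
    (measurableEmbedding_pi_affineChart n _).integral_map, powMoment, slaterLaw,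
    integral_map (by fun_prop) (measurable_ofReal_cpow_const _).aestronglyMeasurable,
    ENNReal.toReal_ofReal (pow_nonneg (fsMass_pos n).le _), Complex.real_smul, Fintype.card_fin]
  simp only [partitionIntegrand_affineChart]

theorem mem_strip_iff {n : ℕ} {β : ℂ} : β ∈ strip n ↔ -1 < (β * (n + 1)).re := by
  have hre : (β * (n + 1)).re = β.re * (n + 1) := by
    exact_mod_cast Complex.re_mul_ofReal β (n + 1)
  rw [strip, Set.mem_ofPred_eq, hre, ← neg_div, div_lt_iff₀ (by positivity)]

theorem integrable_partitionIntegrand_iff {n : ℕ} (hn : 1 ≤ n) (β : ℂ) :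
    Integrable (partitionIntegrand n β) (Measure.pi fun _ : Fin (n + 1) => fsVolume n) ↔
      β ∈ strip n := by
  rw [integrable_partitionIntegrand_iff_absMoment_ne_top, absMoment_slaterLaw_ne_top_iff hn,
    mem_strip_iff]

end PartitionFunction

section ZetaIntegral

theorem zetaIntegrand_eq_mul_smul (N : ℕ) (s : ℂ) (A : Fin N → Fin N → ℂ) :
    zetaIntegrand N s A = (Real.pi ^ N ^ 2 : ℝ) *
      ((ENNReal.ofReal (Real.pi⁻¹ ^ N ^ 2 * Real.exp (-∑ i, ∑ j, ‖A i j‖ ^ 2))).toReal •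
        ((‖(Matrix.of A).det‖ ^ 2 : ℝ) : ℂ) ^ s) := by
  have hpi : (Real.pi : ℂ) ^ N ^ 2 ≠ 0 := pow_ne_zero _ (by exact_mod_cast Real.pi_ne_zero)
  rw [ENNReal.toReal_ofReal (by positivity), Complex.real_smul, zetaIntegrand]
  push_cast
  rw [inv_pow]
  field_simp

theorem integrable_zetaIntegrand {N : ℕ} {s : ℂ} (h : absMoment (detLaw N) s ≠ ∞) :
    Integrable (zetaIntegrand N s) := by
  rw [← integrable_cpow_iff_absMoment_ne_top, detLaw,
    integrable_map_measure (measurable_ofReal_cpow_const _).aestronglyMeasurable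
      (measurable_norm_det_sq N).aemeasurable, ginibre_eq_withDensity,
    integrable_withDensity_iff_integrable_smul' (by fun_prop)
      (Filter.Eventually.of_forall fun _ => ENNReal.ofReal_lt_top)] at h
  exact (h.const_mul ((Real.pi ^ N ^ 2 : ℝ) : ℂ)).congr
    (Filter.Eventually.of_forall fun A => (zetaIntegrand_eq_mul_smul N s A).symm)

theorem zetaIntegral_eq_powMoment (N : ℕ) (s : ℂ) :
    zetaIntegral N s = (Real.pi ^ N ^ 2 : ℝ) * powMoment (detLaw N) s := by
  rw [powMoment, detLaw, integral_map (measurable_norm_det_sq N).aemeasurable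
    (measurable_ofReal_cpow_const _).aestronglyMeasurable, ginibre_eq_withDensity,
    integral_withDensity_eq_integral_toReal_smul (by fun_prop)
      (Filter.Eventually.of_forall fun _ => ENNReal.ofReal_lt_top), ← integral_const_mul]
  simp only [← zetaIntegrand_eq_mul_smul]
  rfl

end ZetaIntegral

section Continuation

theorem meromorphicOrderAt_mul_inv_nonpos {𝕜 : Type*} [NontriviallyNormedField 𝕜] {f : 𝕜 → 𝕜}
    {x c : 𝕜} (hf : AnalyticAt 𝕜 f x) (hf₀ : ∀ᶠ z in nhdsWithin x {x}ᶜ, f z ≠ 0) (hc : c ≠ 0) :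
    meromorphicOrderAt (fun z => c * (f z)⁻¹) x ≤ 0 := by
  classical
  have hnonneg := hf.meromorphicOrderAt_nonneg
  lift meromorphicOrderAt f x to ℤ using
    (meromorphicOrderAt_ne_top_iff_eventually_ne_zero hf.meromorphicAt).2 hf₀ with m hm
  change meromorphicOrderAt ((fun _ => c) * f⁻¹) x ≤ 0
  rw [meromorphicOrderAt_mul (MeromorphicAt.const c x) hf.meromorphicAt.inv,
    meromorphicOrderAt_const, if_neg hc, zero_add, meromorphicOrderAt_inv, ← hm]
  norm_cast at hnonneg ⊢
  simpa using hnonneg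

theorem not_continuousAt_of_mul_eq_const {X R : Type*} [TopologicalSpace X] [TopologicalSpace R]
    [T2Space R] [MulZeroClass R] [ContinuousMul R] {f g : X → R} {S : Set X} {x : X} {c : R}
    (hx : x ∈ closure S) (hf : ContinuousAt f x) (hfx : f x = 0) (hc : c ≠ 0)
    (hgf : ∀ y ∈ S, g y * f y = c) : ¬ ContinuousAt g x := by
  intro hg
  have := mem_closure_iff_nhdsWithin_neBot.1 hx
  have hlim : Filter.Tendsto (g * f) (nhdsWithin x S) (nhds 0) := by
    simpa [hfx] using (hg.mul hf).tendsto.mono_left (nhdsWithin_le_nhds (s := S))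
  have hconst : Filter.Tendsto (g * f) (nhdsWithin x S) (nhds c) :=
    tendsto_const_nhds.congr' (eventually_nhdsWithin_of_forall fun y hy => (hgf y hy).symm)
  exact hc (tendsto_nhds_unique hconst hlim)

theorem eventually_eval_ne_zero {R : Type*} [CommRing R] [IsDomain R] [TopologicalSpace R]
    [T1Space R] {p : Polynomial R} (hp : p ≠ 0) (x : R) :
    ∀ᶠ y in nhdsWithin x {x}ᶜ, p.eval y ≠ 0 :=
  nhdsNE_le_cofinite x (Polynomial.finite_setOfPred_isRoot hp).eventually_cofinite_notMem

end Continuation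

section GammaFormulas

theorem prod_Icc_one_eq_prod_range {M : Type*} [CommMonoid M] (f : ℕ → M) (N : ℕ) :
    ∏ j ∈ Finset.Icc 1 N, f j = ∏ k ∈ Finset.range N, f (k + 1) := by
  rw [← Finset.Ico_succ_right_eq_Icc, Finset.prod_Ico_eq_prod_range]
  simp [add_comm]

theorem ne_neg_natCast_add_one {s : ℂ} (hs : -1 < s.re) (m : ℕ) : s ≠ -((m : ℂ) + 1) := by
  rintro rfl
  simp only [Complex.neg_re, Complex.add_re, Complex.natCast_re, Complex.one_re] at hs
  linarith [(m.cast_nonneg : (0 : ℝ) ≤ m)]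

theorem Gamma_add_natCast_add_one_ne_zero {s : ℂ} (hs : ∀ m : ℕ, s ≠ -((m : ℂ) + 1)) (k : ℕ) :
    Complex.Gamma (s + k + 1) ≠ 0 := by
  refine Complex.Gamma_ne_zero fun m h => hs (m + k) ?_
  push_cast
  linear_combination h

theorem prod_Gamma_div_pow {s : ℂ} (hs : ∀ m : ℕ, s ≠ -((m : ℂ) + 1)) (n : ℕ) :
    (∏ j ∈ Finset.Icc 1 n, Complex.Gamma (s + j)) / Complex.Gamma (s + n + 1) ^ n =
      (∏ i ∈ Finset.Icc 1 n, (s + i) ^ i)⁻¹ := by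
  induction n with
  | zero => simp
  | succ n ih =>
    have hΓ := Gamma_add_natCast_add_one_ne_zero hs n
    have hne : s + n + 1 ≠ 0 := fun h => hs n (by linear_combination h)
    rw [Finset.prod_Icc_succ_top (Nat.le_add_left 1 n),
      Finset.prod_Icc_succ_top (Nat.le_add_left 1 n), mul_inv, ← ih]
    push_cast
    rw [← add_assoc, Complex.Gamma_add_one _ hne, mul_pow, pow_succ (Complex.Gamma _)]
    field_simp

theorem powMoment_slaterLaw_eq (n : ℕ) {s : ℂ} (hs : -1 < s.re) :
    powMoment (slaterLaw n) s =
      n ! ^ (n + 1) * (Complex.Gamma (s + n + 1) ^ (n + 1))⁻¹ * powMoment (detLaw (n + 1)) s := by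
  have hΓ := Gamma_add_natCast_add_one_ne_zero (ne_neg_natCast_add_one hs) n
  have hfactorial : (n ! : ℂ) ≠ 0 := by exact_mod_cast Nat.factorial_ne_zero n
  have hlength : powMoment (stdGamma (n + 1)) s = Complex.Gamma (s + n + 1) / n ! := by
    rw [powMoment_stdGamma (by positivity) (by linarith [(n.cast_nonneg : (0 : ℝ) ≤ n)])]
    simp [Complex.Gamma_nat_eq_factorial, add_assoc]
  rw [powMoment_detLaw_eq_mul_slaterLaw, hlength, div_pow]
  field_simp

/-- The constant `cₙ` of the Gamma-quotient formula for the partition function. -/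
def partitionConst (n : ℕ) : ℝ :=
  fsMass n ^ (n + 1) * n ! ^ (n + 1) / ∏ k ∈ Finset.range (n + 1), (k ! : ℝ)

theorem partitionConst_pos (n : ℕ) : 0 < partitionConst n := by
  have := fsMass_pos n
  unfold partitionConst
  positivity

theorem partitionFunction_eq_gammaQuotient {n : ℕ} {β : ℂ} (hβ : β ∈ strip n) :
    partitionFunction n β = partitionConst n * gammaQuotient n β := by
  have hs := mem_strip_iff.1 hβ
  have hΓ := Gamma_add_natCast_add_one_ne_zero (ne_neg_natCast_add_one hs) n
  have hprod : ∏ j ∈ Finset.Icc 1 n, Complex.Gamma (β * (n + 1) + j) =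
      ∏ k ∈ Finset.range n, Complex.Gamma (β * (n + 1) + k + 1) := by
    simp [prod_Icc_one_eq_prod_range, add_assoc]
  rw [partitionFunction_eq_powMoment, powMoment_slaterLaw_eq n hs, powMoment_detLaw _ hs,
    Finset.prod_div_distrib, gammaQuotient, hprod, Finset.prod_range_succ, partitionConst]
  push_cast
  field_simp
  ring

end GammaFormulas

section PoleDivisor

open Polynomial in
/-- The polynomial `∏ᵢ (β(n+1) + i)ⁱ` in `β`, whose reciprocal is the Gamma quotient. -/
def poleDivisor (n : ℕ) : ℂ[X] := ∏ i ∈ Finset.Icc 1 n, (C (n + 1 : ℂ) * X + C (i : ℂ)) ^ i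

theorem eval_poleDivisor (n : ℕ) (β : ℂ) :
    (poleDivisor n).eval β = ∏ i ∈ Finset.Icc 1 n, (β * (n + 1) + i) ^ i := by
  simp [poleDivisor, Polynomial.eval_prod, mul_comm]

theorem eval_poleDivisor_ne_zero {n : ℕ} {β : ℂ}
    (hβ : ∀ m : ℕ, β * (n + 1) ≠ -((m : ℂ) + 1)) : (poleDivisor n).eval β ≠ 0 := by
  rw [eval_poleDivisor]
  refine Finset.prod_ne_zero_iff.2 fun i hi => pow_ne_zero _ fun h => ?_
  obtain ⟨m, rfl⟩ := Nat.exists_eq_add_of_le' (Finset.mem_Icc.1 hi).1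
  push_cast at h
  exact hβ m (eq_neg_of_add_eq_zero_left h)

theorem eval_poleDivisor_ne_zero_of_mem_strip {n : ℕ} {β : ℂ} (hβ : β ∈ strip n) :
    (poleDivisor n).eval β ≠ 0 :=
  eval_poleDivisor_ne_zero (ne_neg_natCast_add_one (mem_strip_iff.1 hβ))

theorem poleDivisor_ne_zero (n : ℕ) : poleDivisor n ≠ 0 := by
  intro h
  exact eval_poleDivisor_ne_zero_of_mem_strip (β := 0) (mem_strip_iff.2 (by simp))
    (by rw [h, Polynomial.eval_zero])

theorem eval_poleDivisor_neg_inv {n : ℕ} (hn : 1 ≤ n) :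
    (poleDivisor n).eval (-(1 / ((n : ℂ) + 1))) = 0 := by
  have hn₀ : (n : ℂ) + 1 ≠ 0 := by exact_mod_cast n.succ_ne_zero
  rw [eval_poleDivisor]
  refine Finset.prod_eq_zero (Finset.mem_Icc.2 ⟨le_rfl, hn⟩) ?_
  field_simp
  simp

/-- The meromorphic continuation of the partition function to `ℂ`, with value `0` at its poles. -/
def partitionContinuation (n : ℕ) (β : ℂ) : ℂ := partitionConst n * ((poleDivisor n).eval β)⁻¹

theorem partitionContinuation_eq_gammaQuotient {n : ℕ} {β : ℂ}
    (hβ : ∀ m : ℕ, β * (n + 1) ≠ -((m : ℂ) + 1)) :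
    partitionContinuation n β = partitionConst n * gammaQuotient n β := by
  rw [partitionContinuation, eval_poleDivisor, gammaQuotient, prod_Gamma_div_pow hβ]

theorem eqOn_partitionContinuation (n : ℕ) :
    Set.EqOn (partitionContinuation n) (partitionFunction n) (strip n) := fun β hβ => by
  rw [partitionContinuation_eq_gammaQuotient (ne_neg_natCast_add_one (mem_strip_iff.1 hβ)),
    partitionFunction_eq_gammaQuotient hβ]

theorem ofReal_partitionConst_ne_zero (n : ℕ) : (partitionConst n : ℂ) ≠ 0 :=
  Complex.ofReal_ne_zero.2 (partitionConst_pos n).ne'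

theorem meromorphic_partitionContinuation (n : ℕ) : Meromorphic (partitionContinuation n) :=
  fun β => (MeromorphicAt.const _ β).mul
    ((poleDivisor n).differentiable.analyticAt β).meromorphicAt.inv

theorem meromorphicOrderAt_partitionContinuation_nonpos (n : ℕ) (β : ℂ) :
    meromorphicOrderAt (partitionContinuation n) β ≤ 0 :=
  meromorphicOrderAt_mul_inv_nonpos ((poleDivisor n).differentiable.analyticAt β)
    (eventually_eval_ne_zero (poleDivisor_ne_zero n) β) (ofReal_partitionConst_ne_zero n)

theorem differentiableOn_partitionFunction (n : ℕ) :
    DifferentiableOn ℂ (partitionFunction n) (strip n) := by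
  refine DifferentiableOn.congr ?_ (eqOn_partitionContinuation n).symm
  exact ((poleDivisor n).differentiable.differentiableOn.inv
    fun β hβ => eval_poleDivisor_ne_zero_of_mem_strip hβ).const_mul _

theorem partitionFunction_ne_zero {n : ℕ} {β : ℂ} (hβ : β ∈ strip n) :
    partitionFunction n β ≠ 0 := by
  rw [← eqOn_partitionContinuation n hβ]
  exact mul_ne_zero (ofReal_partitionConst_ne_zero n)
    (inv_ne_zero (eval_poleDivisor_ne_zero_of_mem_strip hβ))

theorem not_exists_extension_partitionFunction {n : ℕ} (hn : 1 ≤ n) {a : ℝ}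
    (ha : a < -(1 / ((n : ℝ) + 1))) :
    ¬ ∃ F : ℂ → ℂ, DifferentiableOn ℂ F {β | a < β.re} ∧
        Set.EqOn F (partitionFunction n) (strip n) := by
  rintro ⟨F, hF, hFeq⟩
  have hre : (-(1 / ((n : ℂ) + 1))).re = -(1 / ((n : ℝ) + 1)) := by
    have h := Complex.ofReal_re (-(1 / ((n : ℝ) + 1)))
    push_cast at h
    exact h
  have hcont : ContinuousAt F (-(1 / ((n : ℂ) + 1))) :=
    (hF.differentiableAt ((isOpen_lt continuous_const Complex.continuous_re).mem_nhds
      (by rwa [Set.mem_ofPred_eq, hre]))).continuousAt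
  refine not_continuousAt_of_mul_eq_const (S := strip n) ?_ (poleDivisor n).continuousAt
    (eval_poleDivisor_neg_inv hn) (ofReal_partitionConst_ne_zero n) (fun β hβ => ?_) hcont
  · rw [strip, Complex.closure_setOfPred_lt_re, Set.mem_ofPred_eq, hre]
  · rw [hFeq hβ, ← eqOn_partitionContinuation n hβ, partitionContinuation,
      inv_mul_cancel_right₀ (eval_poleDivisor_ne_zero_of_mem_strip hβ)]

end PoleDivisor

section LFactor

/-- The constant `cₙ'` relating the partition function to the zeta integral. -/
def partitionZetaConst (n : ℕ) : ℝ := fsMass n ^ (n + 1) * n ! ^ (n + 1) / Real.pi ^ (n + 1) ^ 2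

theorem partitionZetaConst_pos (n : ℕ) : 0 < partitionZetaConst n := by
  have := fsMass_pos n
  unfold partitionZetaConst
  positivity

theorem partitionFunction_eq_zetaIntegral {n : ℕ} {β : ℂ} (hβ : β ∈ strip n) :
    partitionFunction n β =
      partitionZetaConst n * (Complex.Gamma (β * (n + 1) + n + 1) ^ (n + 1))⁻¹ *
        zetaIntegral (n + 1) (β * (n + 1)) := by
  have hpi : (Real.pi : ℂ) ^ (n + 1) ^ 2 ≠ 0 := pow_ne_zero _ (by exact_mod_cast Real.pi_ne_zero)
  rw [partitionFunction_eq_powMoment, powMoment_slaterLaw_eq n (mem_strip_iff.1 hβ),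
    zetaIntegral_eq_powMoment, partitionZetaConst]
  push_cast
  field_simp

theorem Gammaℂ_add_natCast (s : ℂ) (k : ℕ) :
    Complex.Gammaℂ (s + k) =
      (2 * Real.pi : ℂ) ^ (-s) * (2 / (2 * Real.pi) ^ k * Complex.Gamma (s + k)) := by
  have hpi : (2 * Real.pi : ℂ) ≠ 0 := by exact_mod_cast Real.two_pi_pos.ne'
  rw [Complex.Gammaℂ_def, neg_add, ← sub_eq_add_neg, Complex.cpow_sub _ _ hpi,
    Complex.cpow_natCast]
  ring

theorem standardLFactor_add_half (N : ℕ) (s : ℂ) :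
    standardLFactor N (s + ((N : ℂ) + 1) / 2) =
      ∏ k ∈ Finset.range N, Complex.Gammaℂ (s + k + 1) := by
  rw [standardLFactor, prod_Icc_one_eq_prod_range,
    ← Finset.prod_range_reflect (fun k : ℕ => Complex.Gammaℂ (s + k + 1))]
  refine Finset.prod_congr rfl fun k hk => ?_
  rw [Nat.sub_sub, Nat.cast_sub (by simpa [add_comm] using Finset.mem_range.1 hk)]
  congr 1
  push_cast
  ring

theorem two_pi_cpow_mul_standardLFactor (N : ℕ) (s : ℂ) :
    (2 * Real.pi : ℂ) ^ (N * s) * standardLFactor N (s + ((N : ℂ) + 1) / 2) =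
      ∏ k ∈ Finset.range N, 2 / (2 * Real.pi) ^ (k + 1) * Complex.Gamma (s + k + 1) := by
  have hpi : (2 * Real.pi : ℂ) ≠ 0 := by exact_mod_cast Real.two_pi_pos.ne'
  have hfactor (k : ℕ) := Gammaℂ_add_natCast s (k + 1)
  push_cast [← add_assoc] at hfactor
  simp only [standardLFactor_add_half, hfactor]
  rw [Finset.prod_mul_distrib, Finset.prod_const, Finset.card_range, Complex.cpow_nat_mul,
    ← mul_assoc, ← mul_pow, ← Complex.cpow_add _ _ hpi, add_neg_cancel, Complex.cpow_zero,
    one_pow, one_mul]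

/-- The constant relating the zeta integral on `Mat(N, ℂ)` to the standard L-factor; for
`N = n + 1` it is `cₙ''`. -/
def zetaLFactorConst (N : ℕ) : ℝ :=
  Real.pi ^ N ^ 2 * ∏ k ∈ Finset.range N, (2 * Real.pi) ^ (k + 1) / (2 * k !)

theorem zetaLFactorConst_pos (N : ℕ) : 0 < zetaLFactorConst N := by
  unfold zetaLFactorConst
  positivity

theorem zetaIntegral_eq_standardLFactor (N : ℕ) {s : ℂ} (hs : -1 < s.re) :
    zetaIntegral N s = zetaLFactorConst N * (2 * Real.pi : ℂ) ^ (N * s) *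
      standardLFactor N (s + ((N : ℂ) + 1) / 2) := by
  rw [mul_assoc, two_pi_cpow_mul_standardLFactor, zetaIntegral_eq_powMoment, powMoment_detLaw N hs,
    zetaLFactorConst]
  push_cast
  rw [mul_assoc, ← Finset.prod_mul_distrib]
  congr 1
  refine Finset.prod_congr rfl fun k _ => ?_
  field_simp

end LFactor

end

theorem mainTheorem9 (n : ℕ) (hn : 1 ≤ n) :
    -- the defining integral converges absolutely exactly on the strip
    (∀ β : ℂ, Integrable (partitionIntegrand n β)
        (Measure.pi fun _ : Fin (n + 1) => fsVolume n) ↔ β ∈ strip n) ∧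
    -- the explicit formula, on the strip and for the meromorphic continuation `M`, which is
    -- zero-free on `ℂ`; the excluded `β` are those where some Gamma factor has a pole
    (∃ c : ℝ, 0 < c ∧
      (∀ β ∈ strip n, partitionFunction n β = c * gammaQuotient n β) ∧
      ∃ M : ℂ → ℂ, Meromorphic M ∧
        Set.EqOn M (partitionFunction n) (strip n) ∧
        (∀ β : ℂ, (∀ m : ℕ, β * (n + 1) ≠ -((m : ℂ) + 1)) → M β = c * gammaQuotient n β) ∧
        ∀ β : ℂ, meromorphicOrderAt M β ≤ 0) ∧
    -- holomorphic and zero-free on the strip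
    DifferentiableOn ℂ (partitionFunction n) (strip n) ∧
    (∀ β ∈ strip n, partitionFunction n β ≠ 0) ∧
    -- the strip is maximal: there is no holomorphic extension to a larger one
    (∀ a : ℝ, a < -(1 / ((n : ℝ) + 1)) →
      ¬ ∃ F : ℂ → ℂ, DifferentiableOn ℂ F {β | a < β.re} ∧
        Set.EqOn F (partitionFunction n) (strip n)) ∧
    -- relation to the zeta integral and to the standard L-factor of `GL(n+1, ℂ)`, `s = β(n+1)`
    (∃ c₁ c₂ : ℝ, 0 < c₁ ∧ 0 < c₂ ∧ ∀ β ∈ strip n,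
      Integrable (zetaIntegrand (n + 1) (β * (n + 1))) ∧
      partitionFunction n β =
        c₁ * (Complex.Gamma (β * (n + 1) + n + 1) ^ (n + 1))⁻¹ *
          zetaIntegral (n + 1) (β * (n + 1)) ∧
      zetaIntegral (n + 1) (β * (n + 1)) =
        c₂ * (2 * Real.pi : ℂ) ^ (((n : ℂ) + 1) * (β * (n + 1))) *
          standardLFactor (n + 1) (β * (n + 1) + ((n : ℂ) + 2) / 2)) := by
  refine ⟨integrable_partitionIntegrand_iff hn, ?formula, differentiableOn_partitionFunction n,
    fun β => partitionFunction_ne_zero, fun a => not_exists_extension_partitionFunction hn, ?zeta⟩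
  case formula =>
    exact ⟨partitionConst n, partitionConst_pos n, fun β => partitionFunction_eq_gammaQuotient,
      partitionContinuation n, meromorphic_partitionContinuation n, eqOn_partitionContinuation n,
      fun β => partitionContinuation_eq_gammaQuotient,
      meromorphicOrderAt_partitionContinuation_nonpos n⟩
  case zeta =>
    refine ⟨partitionZetaConst n, zetaLFactorConst (n + 1), partitionZetaConst_pos n,
      zetaLFactorConst_pos (n + 1), fun β hβ => ?_⟩
    have hs : -1 < (β * (n + 1)).re := mem_strip_iff.1 hβ
    have hL := zetaIntegral_eq_standardLFactor (n + 1) hs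
    rw [Nat.cast_succ, add_assoc (n : ℂ), one_add_one_eq_two] at hL
    exact ⟨integrable_zetaIntegrand ((absMoment_detLaw_succ_ne_top_iff n _).2 hs),
      partitionFunction_eq_zetaIntegral hβ, hL⟩
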